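/- Let $h\in\mathbb{C}$ and let $A=SL_h(2)$ be the Jordanian quantum group: the Hopf algebra over $\mathbb{C}$ generated by $a,b,c,d$ with relations $ca=ac-hc^2$, $cd=dc-hc^2$, $db=bd+h(1-d^2)$, $ab=ba+h(1-a^2)$, $cb=bc-hac-hdc+h^2c^2$, $da=bc+1-hdc$, $ad=bc-hac+1$, with $\Delta(T)=T\otimes T$ and $\varepsilon(T)=1$ for $T=\begin{pmatrix}a&b\\c&d\end{pmatrix}$, and $S(a)=d+hc$, $S(b)=hd-ha-b+h^2c$, $S(c)=-c$, $S(d)=a-hc$. A 3D calculus on $A$ is a first order bicovariant differential calculus $(\Gamma,\mathrm{d},\Delta_L,\Delta_R)$ over $A$ (in the sense of Woronowicz) for which $\theta_1=P(\mathrm{d}a)$, $\theta_2=P(\mathrm{d}b)$, $\theta_3=P(\mathrm{d}c)$ form a basis of the space of left-invariant 1-forms, where $P(\omega)=S(\omega_{(A)})\omega_{(\Gamma)}$. Put $\mathcal{R}=\{x\in\ker\varepsilon: P(\mathrm{d}x)=0\}$ and $\mathcal{L}^{\mathrm{3D}}=(\ker\varepsilon/\mathcal{R})^*\subset A^*$ (functionals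 extended by $0$ at $1$), with the pairing $\langle\,,\rangle:\Gamma\times\mathcal{L}^{\mathrm{3D}}\to\mathbb{C}$ determined by $\langle x\omega,\chi\rangle=\varepsilon(x)\langle\omega,\chi\rangle$, $\langle \mathrm{d}x,\chi\rangle=\chi(x)$. Let $(\chi_1,\chi_2,\chi_3)$ be the basis of $\mathcal{L}^{\mathrm{3D}}$ dual to $(\theta_1,\theta_2,\theta_3)$. The quantum Lie bracket is the right adjoint action, $[\chi,\chi'](x)=\chi(x_{(2)})\,\chi'(S(x_{(1)})x_{(3)})$, and products of functionals are convolution products in $A^*$. Let $f_{ij}\in A^*$ and $v_{ij}\in A$ be the unique elements with $\theta_i x=\sum_j x_{(1)}f_{ij}(x_{(2)})\,\theta_j$ for all $x\in A$ and $\Delta_R(\theta_i)=\sum_j\theta_j\otimes v_{ji}$, and let $\Lambda_{ik,st}=f_{it}(v_{sk})$ be the coefficients of the braiding of $\Gamma\otimes_A\Gamma$. Theorem. A 3D calculus on $SL_h(2)$ exists, and for every 3D calculus the above pairing, dual basis, $f_{ij}$ and $v_{ij}$ exist and are unique. The quantum Lie brackets of $\mathcal{L}^{\mathrm{3D}}$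 are $[\chi_1,\chi_1]=0$, $[\chi_1,\chi_2]=2\chi_2$, $[\chi_1,\chi_3]=-2\chi_3$, $[\chi_2,\chi_1]=-2\chi_2$, $[\chi_2,\chi_2]=0$, $[\chi_2,\chi_3]=\chi_1-4h\chi_2$, $[\chi_3,\chi_1]=-4h\chi_1+2\chi_3$, $[\chi_3,\chi_2]=-\chi_1$, $[\chi_3,\chi_3]=-4h\chi_3$. They are the braided commutators $[\chi_i,\chi_k]=\chi_i\chi_k-\sum_{s,t}\Lambda_{st,ik}\chi_s\chi_t$, where $\sum_{s,t}\Lambda_{st,ik}\,\chi_s\otimes\chi_t$ is $\chi_1\otimes\chi_1$ for $(i,k)=(1,1)$, $\chi_2\otimes\chi_2$ for $(2,2)$, and in the other cases is given by the bracketed terms (with $\otimes$ for the product) in the explicit formulas $[\chi_1,\chi_1]=0$, $[\chi_1,\chi_2]=\chi_1\chi_2-(\chi_2\chi_1+4h\chi_2\chi_2)$, $[\chi_1,\chi_3]=\chi_1\chi_3-(\chi_3\chi_1-4h\chi_3\chi_2)$, $[\chi_2,\chi_1]=\chi_2\chi_1-(\chi_1\chi_2-4h\chi_2\chi_2)$,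 $[\chi_2,\chi_2]=0$, $[\chi_2,\chi_3]=\chi_2\chi_3-(2h\chi_1\chi_2-8h^2\chi_2\chi_2+\chi_3\chi_2)$, $[\chi_3,\chi_1]=\chi_3\chi_1-(\chi_1\chi_3-8h^2\chi_2\chi_1+4h\chi_2\chi_3)$, $[\chi_3,\chi_2]=\chi_3\chi_2-(-2h\chi_2\chi_1+\chi_2\chi_3)$, $[\chi_3,\chi_3]=\chi_3\chi_3-(-2h\chi_1\chi_3+2h\chi_3\chi_1-8h^2\chi_3\chi_2+\chi_3\chi_3)$. -/

import Mathlib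

open scoped TensorProduct

namespace JordanianSL2

/-! ### The Jordanian quantum group `SL_h(2)` -/

/-- The four matrix generators of the coordinate algebra. -/
inductive Gen : Type
  | a | b | c | d

/-- The defining relations of `SL_h(2)`: the Jordanian FRT relations with both parameters equal
to `h`, and quantum determinant `ad - bc + h ac` equal to `1`. -/
inductive Rel (h : ℂ) : FreeAlgebra ℂ Gen → FreeAlgebra ℂ Gen → Prop
  | ca : Rel h (.ι ℂ .c * .ι ℂ .a) (.ι ℂ .a * .ι ℂ .c - h • (.ι ℂ .c * .ι ℂ .c))
  | cd : Rel h (.ι ℂ .c * .ι ℂ .d) (.ι ℂ .d * .ι ℂ .c - h • (.ι ℂ .c * .ι ℂ .c))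
  | db : Rel h (.ι ℂ .d * .ι ℂ .b) (.ι ℂ .b * .ι ℂ .d + h • (1 - .ι ℂ .d * .ι ℂ .d))
  | ab : Rel h (.ι ℂ .a * .ι ℂ .b) (.ι ℂ .b * .ι ℂ .a + h • (1 - .ι ℂ .a * .ι ℂ .a))
  | cb : Rel h (.ι ℂ .c * .ι ℂ .b) (.ι ℂ .b * .ι ℂ .c - h • (.ι ℂ .a * .ι ℂ .c)
      - h • (.ι ℂ .d * .ι ℂ .c) + (h * h) • (.ι ℂ .c * .ι ℂ .c))
  | da : Rel h (.ι ℂ .d * .ι ℂ .a) (.ι ℂ .b * .ι ℂ .c + 1 - h • (.ι ℂ .d * .ι ℂ .c))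
  | ad : Rel h (.ι ℂ .a * .ι ℂ .d) (.ι ℂ .b * .ι ℂ .c - h • (.ι ℂ .a * .ι ℂ .c) + 1)

/-- The coordinate algebra of the Jordanian quantum group `SL_h(2)`. -/
def SL (h : ℂ) : Type := RingQuot (Rel h)

noncomputable instance (h : ℂ) : Ring (SL h) := inferInstanceAs (Ring (RingQuot (Rel h)))

noncomputable instance (h : ℂ) : Algebra ℂ (SL h) :=
  inferInstanceAs (Algebra ℂ (RingQuot (Rel h)))

/-- The quotient map from the free algebra. -/
noncomputable def SL.mk (h : ℂ) : FreeAlgebra ℂ Gen →ₐ[ℂ] SL h := RingQuot.mkAlgHom ℂ (Rel h)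

/-- The generators of `SL_h(2)`. -/
noncomputable def SL.gen (h : ℂ) (x : Gen) : SL h := SL.mk h (.ι ℂ x)

/-- Seven relations, for a quadruple of elements of an algebra. -/
structure IsPoint {B : Type*} [Ring B] [Algebra ℂ B] (h : ℂ) (a b c d : B) : Prop where
  ca : c * a = a * c - h • (c * c)
  cd : c * d = d * c - h • (c * c)
  db : d * b = b * d + h • (1 - d * d)
  ab : a * b = b * a + h • (1 - a * a)
  cb : c * b = b * c - h • (a * c) - h • (d * c) + (h * h) • (c * c)
  da : d * a = b * c + 1 - h • (d * c)
  ad : a * d = b * c - h • (a * c) + 1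

namespace SL

variable {h : ℂ}

theorem isPoint : IsPoint h (gen h .a) (gen h .b) (gen h .c) (gen h .d) := by
  have key : ∀ {x y : FreeAlgebra ℂ Gen}, Rel h x y → mk h x = mk h y :=
    fun r => RingQuot.mkAlgHom_rel ℂ r
  constructor
  · simpa [gen] using key Rel.ca
  · simpa [gen] using key Rel.cd
  · simpa [gen] using key Rel.db
  · simpa [gen] using key Rel.ab
  · simpa [gen] using key Rel.cb
  · simpa [gen] using key Rel.da
  · simpa [gen] using key Rel.ad

/-- The value of a generator at a quadruple. -/
def pick {B : Type*} (a b c d : B) : Gen → B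
  | .a => a
  | .b => b
  | .c => c
  | .d => d

/-- The universal property of `SL_h(2)`. -/
noncomputable def lift {B : Type*} [Ring B] [Algebra ℂ B] {a b c d : B} (H : IsPoint h a b c d) :
    SL h →ₐ[ℂ] B :=
  RingQuot.liftAlgHom ℂ ⟨FreeAlgebra.lift ℂ (pick a b c d), by
    intro x y r
    cases r
    · simpa [pick] using H.ca
    · simpa [pick] using H.cd
    · simpa [pick] using H.db
    · simpa [pick] using H.ab
    · simpa [pick] using H.cb
    · simpa [pick] using H.da
    · simpa [pick] using H.ad⟩

theorem lift_gen {B : Type*} [Ring B] [Algebra ℂ B] {a b c d : B} (H : IsPoint h a b c d)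
    (x : Gen) : lift H (gen h x) = pick a b c d x := by
  have : lift H (gen h x) = FreeAlgebra.lift ℂ (pick a b c d) (.ι ℂ x) :=
    RingQuot.liftAlgHom_mkAlgHom_apply ..
  rw [this, FreeAlgebra.lift_ι_apply]

theorem mk_surjective : Function.Surjective (mk h) := RingQuot.mkAlgHom_surjective ℂ (Rel h)

theorem induction {p : SL h → Prop} (hs : ∀ r : ℂ, p (algebraMap ℂ (SL h) r))
    (hg : ∀ x, p (gen h x)) (ha : ∀ x y, p x → p y → p (x + y))
    (hm : ∀ x y, p x → p y → p (x * y)) (x : SL h) : p x := by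
  obtain ⟨y, rfl⟩ := mk_surjective x
  induction y using FreeAlgebra.induction with
  | grade0 r => simpa using hs r
  | grade1 x => exact hg x
  | mul x y hx hy => simpa using hm _ _ hx hy
  | add x y hx hy => simpa using ha _ _ hx hy

theorem hom_ext {B : Type*} [Ring B] [Algebra ℂ B] {f g : SL h →ₐ[ℂ] B}
    (H : ∀ x, f (gen h x) = g (gen h x)) : f = g := by
  ext x
  induction x using SL.induction with
  | hs r => simp
  | hg x => exact H x
  | ha x y hx hy => simp [hx, hy]
  | hm x y hx hy => simp [hx, hy]

theorem comul_isPoint : IsPoint (B := SL h ⊗[ℂ] SL h) h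
    (gen h .a ⊗ₜ gen h .a + gen h .b ⊗ₜ gen h .c) (gen h .a ⊗ₜ gen h .b + gen h .b ⊗ₜ gen h .d)
    (gen h .c ⊗ₜ gen h .a + gen h .d ⊗ₜ gen h .c)
    (gen h .c ⊗ₜ gen h .b + gen h .d ⊗ₜ gen h .d) := by
  obtain ⟨ca, cd, db, ab, cb, da, ad⟩ := isPoint (h := h)
  generalize gen h .a = a at *
  generalize gen h .b = b at *
  generalize gen h .c = c at *
  generalize gen h .d = d at *
  constructor <;>
  · simp only [mul_add, add_mul, Algebra.TensorProduct.tmul_mul_tmul, ca, cd, db, ab, cb, da, ad,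
      Algebra.TensorProduct.one_def]
    simp only [TensorProduct.add_tmul, TensorProduct.tmul_add, TensorProduct.sub_tmul,
      TensorProduct.tmul_sub, TensorProduct.tmul_smul, ← TensorProduct.smul_tmul']
    module

theorem counit_isPoint : IsPoint (B := ℂ) h 1 0 0 1 := by
  constructor <;> simp

theorem antipode_isPoint : IsPoint (B := (SL h)ᵐᵒᵖ) h
    (MulOpposite.op (gen h .d + h • gen h .c))
    (MulOpposite.op (h • gen h .d - h • gen h .a - gen h .b + (h * h) • gen h .c))
    (MulOpposite.op (-gen h .c)) (MulOpposite.op (gen h .a - h • gen h .c)) := by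
  obtain ⟨ca, cd, db, ab, cb, da, ad⟩ := isPoint (h := h)
  generalize gen h .a = a at *
  generalize gen h .b = b at *
  generalize gen h .c = c at *
  generalize gen h .d = d at *
  constructor <;>
  · apply MulOpposite.unop_injective
    simp only [MulOpposite.unop_mul, MulOpposite.unop_op, MulOpposite.unop_add,
      MulOpposite.unop_sub, MulOpposite.unop_smul, MulOpposite.unop_one]
    simp only [mul_add, add_mul, mul_sub, sub_mul, mul_neg, neg_mul, smul_mul_assoc,
      mul_smul_comm, ca, cd, db, ab, cb, da, ad]
    module

/-- The coproduct `Δ(T) = T ⊗ T`. -/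
noncomputable def comulHom (h : ℂ) : SL h →ₐ[ℂ] SL h ⊗[ℂ] SL h := lift comul_isPoint

/-- The counit `ε(T) = 1`. -/
noncomputable def counitHom (h : ℂ) : SL h →ₐ[ℂ] ℂ := lift counit_isPoint

/-- The antipode, as an algebra map into the opposite algebra: `S(a) = d + hc`,
`S(b) = hd - ha - b + h²c`, `S(c) = -c`, `S(d) = a - hc`. -/
noncomputable def antipodeHom (h : ℂ) : SL h →ₐ[ℂ] (SL h)ᵐᵒᵖ := lift antipode_isPoint

noncomputable instance instBialgebra (h : ℂ) : Bialgebra ℂ (SL h) :=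
  Bialgebra.ofAlgHom (comulHom h) (counitHom h)
    (hom_ext fun x => by
      cases x <;> simp [comulHom, lift_gen, pick, TensorProduct.add_tmul, TensorProduct.tmul_add]
      all_goals abel)
    (hom_ext fun x => by cases x <;> simp [comulHom, counitHom, lift_gen, pick])
    (hom_ext fun x => by cases x <;> simp [comulHom, counitHom, lift_gen, pick])

theorem comul_eq (x : SL h) : Coalgebra.comul (R := ℂ) x = comulHom h x := rfl

theorem counit_eq (x : SL h) : Coalgebra.counit (R := ℂ) x = counitHom h x := rfl

/-- The antipode as a linear map. -/
noncomputable def antipodeLin (h : ℂ) : SL h →ₗ[ℂ] SL h :=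
  (MulOpposite.opLinearEquiv ℂ).symm.toLinearMap ∘ₗ (antipodeHom h).toLinearMap

theorem antipodeLin_mul (x y : SL h) :
    antipodeLin h (x * y) = antipodeLin h y * antipodeLin h x := by
  simp [antipodeLin]

theorem antipodeLin_one : antipodeLin h 1 = 1 := by
  simp [antipodeLin]

theorem antipodeLin_gen (x : Gen) : antipodeLin h (gen h x) =
    pick (gen h .d + h • gen h .c) (h • gen h .d - h • gen h .a - gen h .b + (h * h) • gen h .c)
      (-gen h .c) (gen h .a - h • gen h .c) x := by
  cases x <;> simp [antipodeLin, antipodeHom, lift_gen, pick]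

theorem antipode_left_aux {X : SL h ⊗[ℂ] SL h} {r : ℂ}
    (hX : LinearMap.mul' ℂ (SL h) ((antipodeLin h).rTensor (SL h) X) = algebraMap ℂ (SL h) r)
    (Y : SL h ⊗[ℂ] SL h) :
    LinearMap.mul' ℂ (SL h) ((antipodeLin h).rTensor (SL h) (X * Y)) =
      r • LinearMap.mul' ℂ (SL h) ((antipodeLin h).rTensor (SL h) Y) := by
  induction Y using TensorProduct.induction_on with
  | zero => simp
  | add Y Z hY hZ => simp only [mul_add, map_add, hY, hZ, smul_add]
  | tmul u v =>
    have : ∀ X : SL h ⊗[ℂ] SL h,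
        LinearMap.mul' ℂ (SL h) ((antipodeLin h).rTensor (SL h) (X * u ⊗ₜ v)) =
        antipodeLin h u * LinearMap.mul' ℂ (SL h) ((antipodeLin h).rTensor (SL h) X) * v := by
      intro X
      induction X using TensorProduct.induction_on with
      | zero => simp
      | add Y Z hY hZ => simp only [mul_add, add_mul, map_add, hY, hZ]
      | tmul s t => simp [antipodeLin_mul, mul_assoc]
    rw [this, hX, Algebra.algebraMap_eq_smul_one]
    simp

theorem antipode_right_aux {Y : SL h ⊗[ℂ] SL h} {r : ℂ}
    (hY : LinearMap.mul' ℂ (SL h) ((antipodeLin h).lTensor (SL h) Y) = algebraMap ℂ (SL h) r)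
    (X : SL h ⊗[ℂ] SL h) :
    LinearMap.mul' ℂ (SL h) ((antipodeLin h).lTensor (SL h) (X * Y)) =
      r • LinearMap.mul' ℂ (SL h) ((antipodeLin h).lTensor (SL h) X) := by
  induction X using TensorProduct.induction_on with
  | zero => simp
  | add Y Z hY hZ => simp only [add_mul, map_add, hY, hZ, smul_add]
  | tmul u v =>
    have : ∀ Y : SL h ⊗[ℂ] SL h,
        LinearMap.mul' ℂ (SL h) ((antipodeLin h).lTensor (SL h) (u ⊗ₜ v * Y)) =
        u * LinearMap.mul' ℂ (SL h) ((antipodeLin h).lTensor (SL h) Y) * antipodeLin h v := by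
      intro Y
      induction Y using TensorProduct.induction_on with
      | zero => simp
      | add Y Z hY hZ => simp only [mul_add, add_mul, map_add, hY, hZ]
      | tmul s t => simp [antipodeLin_mul, mul_assoc]
    rw [this, hY, Algebra.algebraMap_eq_smul_one]
    simp

theorem antipode_left (x : SL h) :
    LinearMap.mul' ℂ (SL h) ((antipodeLin h).rTensor (SL h) (comulHom h x)) =
      algebraMap ℂ (SL h) (counitHom h x) := by
  induction x using SL.induction with
  | hs r => simp [Algebra.algebraMap_eq_smul_one, Algebra.TensorProduct.one_def, antipodeLin_one]
  | ha x y hx hy => simp only [map_add, hx, hy]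
  | hm x y hx hy =>
    rw [map_mul, antipode_left_aux hx, hy, map_mul, map_mul, Algebra.smul_def]
  | hg x =>
    obtain ⟨ca, cd, db, ab, cb, da, ad⟩ := isPoint (h := h)
    cases x <;>
    · simp [comulHom, counitHom, lift_gen, pick, antipodeLin_gen, add_mul, sub_mul,
        ca, cd, db, cb, da, ad]
      try module

theorem antipode_right (x : SL h) :
    LinearMap.mul' ℂ (SL h) ((antipodeLin h).lTensor (SL h) (comulHom h x)) =
      algebraMap ℂ (SL h) (counitHom h x) := by
  induction x using SL.induction with
  | hs r => simp [Algebra.algebraMap_eq_smul_one, Algebra.TensorProduct.one_def, antipodeLin_one]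
  | ha x y hx hy => simp only [map_add, hx, hy]
  | hm x y hx hy =>
    rw [map_mul, antipode_right_aux hy, hx, map_mul, map_mul, Algebra.smul_def, Algebra.commutes]
  | hg x =>
    obtain ⟨ca, cd, db, ab, cb, da, ad⟩ := isPoint (h := h)
    cases x <;>
    · simp [comulHom, counitHom, lift_gen, pick, antipodeLin_gen, mul_add, mul_sub,
        ca, cd, ab, cb, da, ad]
      try module

noncomputable instance instHopfAlgebra (h : ℂ) : HopfAlgebra ℂ (SL h) where
  antipode := antipodeLin h
  mul_antipode_rTensor_comul := LinearMap.ext antipode_left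
  mul_antipode_lTensor_comul := LinearMap.ext antipode_right

end SL

/-! ### Bicovariant differential calculi over a Hopf algebra -/

section Calculus

open Coalgebra HopfAlgebra

variable (A : Type*) [Ring A] [HopfAlgebra ℂ A]

section Actions

variable (Γ : Type*) [AddCommGroup Γ] [Module ℂ Γ] [Module A Γ] [Module Aᵐᵒᵖ Γ]
  [IsScalarTower ℂ A Γ] [IsScalarTower ℂ Aᵐᵒᵖ Γ]

/-- The left multiplication `a ↦ (ω ↦ a ω)` of an `A`-bimodule. -/
noncomputable def lact : A →ₗ[ℂ] Γ →ₗ[ℂ] Γ := (Algebra.lsmul ℂ ℂ Γ).toLinearMap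

/-- The right multiplication `b ↦ (ω ↦ ω b)` of an `A`-bimodule. -/
noncomputable def ract : A →ₗ[ℂ] Γ →ₗ[ℂ] Γ :=
  (Algebra.lsmul ℂ ℂ Γ : Aᵐᵒᵖ →ₐ[ℂ] Module.End ℂ Γ).toLinearMap ∘ₗ
    (MulOpposite.opLinearEquiv ℂ).toLinearMap

/-- `(a ⊗ a') · (x ⊗ ω) = a x ⊗ a' ω`. -/
noncomputable def lactAΓ : A ⊗[ℂ] A →ₗ[ℂ] A ⊗[ℂ] Γ →ₗ[ℂ] A ⊗[ℂ] Γ :=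
  TensorProduct.map₂ (LinearMap.mul ℂ A) (lact A Γ)

/-- `(x ⊗ ω) · (b ⊗ b') = x b ⊗ ω b'`, with the acting element as the first argument. -/
noncomputable def ractAΓ : A ⊗[ℂ] A →ₗ[ℂ] A ⊗[ℂ] Γ →ₗ[ℂ] A ⊗[ℂ] Γ :=
  TensorProduct.map₂ (LinearMap.mul ℂ A).flip (ract A Γ)

/-- `(a ⊗ a') · (ω ⊗ x) = a ω ⊗ a' x`. -/
noncomputable def lactΓA : A ⊗[ℂ] A →ₗ[ℂ] Γ ⊗[ℂ] A →ₗ[ℂ] Γ ⊗[ℂ] A :=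
  TensorProduct.map₂ (lact A Γ) (LinearMap.mul ℂ A)

/-- `(ω ⊗ x) · (b ⊗ b') = ω b ⊗ x b'`, with the acting element as the first argument. -/
noncomputable def ractΓA : A ⊗[ℂ] A →ₗ[ℂ] Γ ⊗[ℂ] A →ₗ[ℂ] Γ ⊗[ℂ] A :=
  TensorProduct.map₂ (ract A Γ) (LinearMap.mul ℂ A).flip

end Actions

variable (Γ : Type*) [AddCommGroup Γ] [Module ℂ Γ] [Module A Γ] [Module Aᵐᵒᵖ Γ]
  [SMulCommClass A Aᵐᵒᵖ Γ] [IsScalarTower ℂ A Γ] [IsScalarTower ℂ Aᵐᵒᵖ Γ]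

/-- A first order differential calculus over `A` with bimodule of 1-forms `Γ`. -/
structure FirstOrderCalculus where
  /-- the differential -/
  d : A →ₗ[ℂ] Γ
  leibniz : ∀ a b : A, d (a * b) = MulOpposite.op b • d a + a • d b
  span_d : Submodule.span ℂ {ω : Γ | ∃ a b : A, ω = a • d b} = ⊤

/-- A bicovariant bimodule structure on the `A`-bimodule `Γ`. -/
structure BicovariantBimodule where
  /-- the left coaction -/
  coactL : Γ →ₗ[ℂ] A ⊗[ℂ] Γ
  /-- the right coaction -/
  coactR : Γ →ₗ[ℂ] Γ ⊗[ℂ] A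
  coassocL : ∀ ω, TensorProduct.assoc ℂ A A Γ ((comul (R := ℂ) (A := A)).rTensor Γ (coactL ω)) =
    coactL.lTensor A (coactL ω)
  counitL : ∀ ω, TensorProduct.lid ℂ Γ ((counit (R := ℂ) (A := A)).rTensor Γ (coactL ω)) = ω
  coassocR : ∀ ω, TensorProduct.assoc ℂ Γ A A (coactR.rTensor A (coactR ω)) =
    (comul (R := ℂ) (A := A)).lTensor Γ (coactR ω)
  counitR : ∀ ω, TensorProduct.rid ℂ Γ ((counit (R := ℂ) (A := A)).lTensor Γ (coactR ω)) = ω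
  coactL_coactR : ∀ ω, TensorProduct.assoc ℂ A Γ A (coactL.rTensor A (coactR ω)) =
    coactR.lTensor A (coactL ω)
  coactL_lsmul : ∀ (a : A) (ω : Γ), coactL (a • ω) = lactAΓ A Γ (comul a) (coactL ω)
  coactL_rsmul : ∀ (b : A) (ω : Γ),
    coactL (MulOpposite.op b • ω) = ractAΓ A Γ (comul b) (coactL ω)
  coactR_lsmul : ∀ (a : A) (ω : Γ), coactR (a • ω) = lactΓA A Γ (comul a) (coactR ω)
  coactR_rsmul : ∀ (b : A) (ω : Γ),
    coactR (MulOpposite.op b • ω) = ractΓA A Γ (comul b) (coactR ω)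

/-- A first order bicovariant differential calculus over the Hopf algebra `A`. -/
structure BicovariantCalculus extends FirstOrderCalculus A Γ, BicovariantBimodule A Γ where
  coactL_d : ∀ a, coactL (d a) = d.lTensor A (comul a)
  coactR_d : ∀ a, coactR (d a) = d.rTensor A (comul a)

variable {A}

/-- `φ ⋆ a = a₍₁₎ φ(a₍₂₎)`. -/
noncomputable def starAct (φ : Module.Dual ℂ A) (a : A) : A :=
  TensorProduct.rid ℂ A (φ.lTensor A (comul a))

/-- The convolution product `(φ ψ)(a) = φ(a₍₁₎) ψ(a₍₂₎)` of the dual algebra `A*`. -/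
noncomputable def convol (φ ψ : Module.Dual ℂ A) : Module.Dual ℂ A :=
  LinearMap.mul' ℂ ℂ ∘ₗ TensorProduct.map φ ψ ∘ₗ comul

variable {Γ} in
/-- `f` is the family of functionals with `θᵢ a = ∑ⱼ (fᵢⱼ ⋆ a) θⱼ`. -/
def IsCommutation {n : ℕ} (θ : Fin n → Γ) (f : Fin n → Fin n → Module.Dual ℂ A) : Prop :=
  ∀ i a, MulOpposite.op a • θ i = ∑ j, starAct (f i j) a • θ j

variable (A) in
/-- The right adjoint coaction `a ↦ a₍₂₎ ⊗ S(a₍₁₎) a₍₃₎`. -/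
noncomputable def adR : A →ₗ[ℂ] A ⊗[ℂ] A :=
  (LinearMap.mul' ℂ A ∘ₗ (antipode ℂ (A := A)).rTensor A).lTensor A ∘ₗ
    (TensorProduct.leftComm ℂ A A A).toLinearMap ∘ₗ
      (comul (R := ℂ) (A := A)).lTensor A ∘ₗ comul

/-- The right adjoint action `χ ◁ α = S(α₍₁₎) χ α₍₂₎` of `A*`, that is
`(χ ◁ α)(a) = χ(a₍₂₎) α(S(a₍₁₎) a₍₃₎)`. Restricted to a quantum Lie algebra, this is the
quantum Lie bracket `[χ, α]`. -/
noncomputable def qbracket (χ α : Module.Dual ℂ A) : Module.Dual ℂ A :=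
  LinearMap.mul' ℂ ℂ ∘ₗ TensorProduct.map χ α ∘ₗ adR A

namespace BicovariantCalculus

variable {Γ} (C : BicovariantCalculus A Γ)

/-- The space `Γ_inv` of left-invariant 1-forms. -/
noncomputable def leftInvariant : Submodule ℂ Γ where
  carrier := {ω | C.coactL ω = 1 ⊗ₜ ω}
  add_mem' := by
    intro x y hx hy
    change C.coactL (x + y) = 1 ⊗ₜ (x + y)
    rw [map_add, show C.coactL x = _ from hx, show C.coactL y = _ from hy, TensorProduct.tmul_add]
  zero_mem' := by simp
  smul_mem' := by
    intro r x hx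
    change C.coactL (r • x) = 1 ⊗ₜ (r • x)
    rw [map_smul, show C.coactL x = _ from hx, TensorProduct.tmul_smul]

/-- The projection `P(ω) = S(ω₍A₎) ω₍Γ₎` onto the left-invariant 1-forms. -/
noncomputable def proj : Γ →ₗ[ℂ] Γ :=
  TensorProduct.lift (lact A Γ ∘ₗ antipode ℂ) ∘ₗ C.coactL

/-- The ideal `R = {a ∈ ker ε : P(da) = 0}` of the calculus (as a subspace). -/
noncomputable def ideal : Submodule ℂ A :=
  LinearMap.ker (counit (R := ℂ) (A := A)) ⊓ LinearMap.ker (C.proj ∘ₗ C.d)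

/-- The quantum Lie algebra `L = (ker ε / R)*`, realised inside `A* = (ℂ 1 ⊕ ker ε)*` as the
functionals that vanish at `1` and on `R`. -/
noncomputable def quantumLie : Submodule ℂ (Module.Dual ℂ A) :=
  (Submodule.span ℂ {1} ⊔ C.ideal).dualAnnihilator

/-- The defining properties of the pairing `⟨ , ⟩ : Γ × L → ℂ`. -/
structure IsPairing (B : Γ →ₗ[ℂ] C.quantumLie →ₗ[ℂ] ℂ) : Prop where
  smul : ∀ (a : A) (ω : Γ) (χ : C.quantumLie), B (a • ω) χ = counit (R := ℂ) a * B ω χ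
  d : ∀ (a : A) (χ : C.quantumLie), B (C.d a) χ = (χ : Module.Dual ℂ A) a

/-- `v` is the matrix of the right coaction: `Δ_R(θᵢ) = ∑ⱼ θⱼ ⊗ vⱼᵢ`. -/
def IsCoactionMatrix {n : ℕ} (θ : Fin n → Γ) (v : Fin n → Fin n → A) : Prop :=
  ∀ i, C.coactR (θ i) = ∑ j, θ j ⊗ₜ[ℂ] v j i

end BicovariantCalculus

/-- The coefficients of the braiding of `Γ ⊗_A Γ` on left-invariant forms,
`Λ(θᵢ ⊗ θₖ) = ∑ₛₜ Λ_{ik,st} θₛ ⊗ θₜ`, namely `Λ_{ik,st} = f_{it}(v_{sk})`. -/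
def braiding {n : ℕ} (f : Fin n → Fin n → Module.Dual ℂ A) (v : Fin n → Fin n → A)
    (i k s t : Fin n) : ℂ :=
  f i t (v s k)

end Calculus

/-! ### Three-dimensional calculi on `SL_h(2)` and the tables -/

section ThreeDim

variable {h : ℂ} {Γ : Type*} [AddCommGroup Γ] [Module ℂ Γ] [Module (SL h) Γ]
  [Module (SL h)ᵐᵒᵖ Γ] [SMulCommClass (SL h) (SL h)ᵐᵒᵖ Γ] [IsScalarTower ℂ (SL h) Γ]
  [IsScalarTower ℂ (SL h)ᵐᵒᵖ Γ]

/-- The left-invariant 1-forms `θ₁ = P(da)`, `θ₂ = P(db)`, `θ₃ = P(dc)`. -/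
noncomputable def theta (C : BicovariantCalculus (SL h) Γ) : Fin 3 → Γ :=
  ![C.proj (C.d (SL.gen h .a)), C.proj (C.d (SL.gen h .b)), C.proj (C.d (SL.gen h .c))]

/-- A 3D calculus: `θ₁, θ₂, θ₃` form a basis of the space of left-invariant 1-forms. -/
def IsThreeDim (C : BicovariantCalculus (SL h) Γ) : Prop :=
  LinearIndependent ℂ (theta C) ∧ Submodule.span ℂ (Set.range (theta C)) = C.leftInvariant

/-- The table of quantum Lie brackets. -/
def BracketTable (h : ℂ) {V : Type*} [AddCommGroup V] [Module ℂ V] (br : V → V → V)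
    (χ₁ χ₂ χ₃ : V) : Prop :=
  br χ₁ χ₁ = 0 ∧
  br χ₁ χ₂ = (2 : ℂ) • χ₂ ∧
  br χ₁ χ₃ = (-2 : ℂ) • χ₃ ∧
  br χ₂ χ₁ = (-2 : ℂ) • χ₂ ∧
  br χ₂ χ₂ = 0 ∧
  br χ₂ χ₃ = χ₁ - (4 * h) • χ₂ ∧
  br χ₃ χ₁ = (-4 * h) • χ₁ + (2 : ℂ) • χ₃ ∧
  br χ₃ χ₂ = -χ₁ ∧
  br χ₃ χ₃ = (-4 * h) • χ₃

/-- The table of the braided flips: `σ i k` is the braided replacement of the flipped product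
`χₖ χᵢ` in the commutator of `χᵢ` and `χₖ`, and `m` is a product. -/
def BraidedFlipTable (h : ℂ) {V W : Type*} [AddCommGroup W] [Module ℂ W]
    (m : V → V → W) (χ₁ χ₂ χ₃ : V) (σ : Fin 3 → Fin 3 → W) : Prop :=
  σ 0 0 = m χ₁ χ₁ ∧
  σ 0 1 = m χ₂ χ₁ + (4 * h) • m χ₂ χ₂ ∧
  σ 0 2 = m χ₃ χ₁ - (4 * h) • m χ₃ χ₂ ∧
  σ 1 0 = m χ₁ χ₂ - (4 * h) • m χ₂ χ₂ ∧
  σ 1 1 = m χ₂ χ₂ ∧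
  σ 1 2 = (2 * h) • m χ₁ χ₂ - (8 * h ^ 2) • m χ₂ χ₂ + m χ₃ χ₂ ∧
  σ 2 0 = m χ₁ χ₃ - (8 * h ^ 2) • m χ₂ χ₁ + (4 * h) • m χ₂ χ₃ ∧
  σ 2 1 = (-2 * h) • m χ₂ χ₁ + m χ₂ χ₃ ∧
  σ 2 2 = (-2 * h) • m χ₁ χ₃ + (2 * h) • m χ₃ χ₁ - (8 * h ^ 2) • m χ₃ χ₂ + m χ₃ χ₃

/-- The table of quantum commutators, for a bracket `br` and a product `m`. -/
def CommutatorTable (h : ℂ) {V : Type*} [AddCommGroup V] [Module ℂ V] (br m : V → V → V)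
    (χ₁ χ₂ χ₃ : V) : Prop :=
  br χ₁ χ₁ = 0 ∧
  br χ₁ χ₂ = m χ₁ χ₂ - (m χ₂ χ₁ + (4 * h) • m χ₂ χ₂) ∧
  br χ₁ χ₃ = m χ₁ χ₃ - (m χ₃ χ₁ - (4 * h) • m χ₃ χ₂) ∧
  br χ₂ χ₁ = m χ₂ χ₁ - (m χ₁ χ₂ - (4 * h) • m χ₂ χ₂) ∧
  br χ₂ χ₂ = 0 ∧
  br χ₂ χ₃ = m χ₂ χ₃ - ((2 * h) • m χ₁ χ₂ - (8 * h ^ 2) • m χ₂ χ₂ + m χ₃ χ₂) ∧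
  br χ₃ χ₁ = m χ₃ χ₁ - (m χ₁ χ₃ - (8 * h ^ 2) • m χ₂ χ₁ + (4 * h) • m χ₂ χ₃) ∧
  br χ₃ χ₂ = m χ₃ χ₂ - ((-2 * h) • m χ₂ χ₁ + m χ₂ χ₃) ∧
  br χ₃ χ₃ = m χ₃ χ₃ -
    ((-2 * h) • m χ₁ χ₃ + (2 * h) • m χ₃ χ₁ - (8 * h ^ 2) • m χ₃ χ₂ + m χ₃ χ₃)

end ThreeDim

end JordanianSL2

open JordanianSL2

/-! A 3D calculus is encoded by functionals: `θᵢ x = ∑ⱼ (fᵢⱼ ⋆ x) θⱼ` and `dx = ∑ᵢ (χᵢ ⋆ x) θᵢ`.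
That these define a right action and a derivation says exactly that `f`, `χ` and the counit form a
block triangular representation of `A` on a space of dimension 4. Covariance on the right says that
the coaction matrix `v` intertwines the two regular actions of these functionals on `A`.

Existence: the representation is given on generators, where only the seven relations need checking
(`refMat_isPoint`). The intertwining property compares two algebra maps into matrices over `A`, so
generators suffice again (`starHom_mul_refW`). The calculus then lives on the free left module with
basis `θ₁, θ₂, θ₃`.

Uniqueness: for an arbitrary 3D calculus, coordinates of `P` give functionals obeying the same
product rules, so their values on the generators determine them (`coord_eq`). The coaction on
`P(dd)` fixes `χ` at `d` (`coordChi_gen_d`), which fixes `v`. The Leibniz rule on the relations,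
with right covariance at `a`, is then a linear system that fixes `f` on the generators (`eq_genF`).
Identities in `A` are turned into scalar equations by evaluating the functionals `refChi` of the
constructed calculus on them, so no basis of `A` is needed.

Brackets: right covariance of the differential reads `χᵢ(x₍₁₎) x₍₂₎ = ∑ₜ (χₜ ⋆ x) vᵢₜ`. Multiplying
by the antipode on the left and applying `χₖ` gives `[χᵢ, χₖ] = ∑ₜ χₖ(vᵢₜ) χₜ` (`qbracket_refChi`).
Applying `χₖ` directly and using its product rule gives `χᵢ χₖ = ∑ₛₜ fₛₖ(vᵢₜ) χₛ χₜ + [χᵢ, χₖ]`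
(`convol_refChi`), where `fₛₖ(vᵢₜ)` is the braiding coefficient. The tables are the values of `χₖ`
and `fₛₖ` on `v`. -/

namespace JordanianSL2

/-! ### The two regular actions of `A*` on a Hopf algebra `A` -/

section Regular

open Coalgebra HopfAlgebra

variable {A : Type*} [Ring A] [HopfAlgebra ℂ A]

/-- The map `a ↦ φ ⋆ a = a₍₁₎ φ(a₍₂₎)` as a linear map. -/
noncomputable def starLin (φ : Module.Dual ℂ A) : A →ₗ[ℂ] A :=
  (TensorProduct.rid ℂ A).toLinearMap ∘ₗ φ.lTensor A ∘ₗ comul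

theorem starLin_apply (φ : Module.Dual ℂ A) (a : A) : starLin φ a = starAct φ a := rfl

/-- The map `a ↦ φ(a₍₁₎) a₍₂₎`. -/
noncomputable def costarLin (φ : Module.Dual ℂ A) : A →ₗ[ℂ] A :=
  (TensorProduct.lid ℂ A).toLinearMap ∘ₗ φ.rTensor A ∘ₗ comul

/-- The functional is recovered from its action; this is what makes the `fᵢⱼ` unique. -/
theorem counit_starAct (φ : Module.Dual ℂ A) (a : A) : counit (R := ℂ) (starAct φ a) = φ a := by
  have key : ∀ X : A ⊗[ℂ] A, counit (R := ℂ) (TensorProduct.rid ℂ A (φ.lTensor A X)) =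
      φ (TensorProduct.lid ℂ A ((counit (R := ℂ) (A := A)).rTensor A X)) := by
    intro X
    induction X using TensorProduct.induction_on with
    | zero => simp
    | add X Y hX hY => simp only [map_add, hX, hY]
    | tmul x y => simp [mul_comm]
  rw [starAct, key, rTensor_counit_comul, TensorProduct.lid_tmul, one_smul]

/-- Coassociativity: `φ` acts on the last leg only. Left covariance of the calculus rests on this.
-/
theorem comul_starAct (φ : Module.Dual ℂ A) (a : A) :
    comul (R := ℂ) (starAct φ a) = (starLin φ).lTensor A (comul a) := by
  have key : ∀ X : A ⊗[ℂ] A, comul (R := ℂ) (TensorProduct.rid ℂ A (φ.lTensor A X)) =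
      ((TensorProduct.rid ℂ A).toLinearMap ∘ₗ φ.lTensor A).lTensor A
        (TensorProduct.assoc ℂ A A A ((comul (R := ℂ) (A := A)).rTensor A X)) := by
    intro X
    induction X using TensorProduct.induction_on with
    | zero => simp
    | add X Y hX hY => simp only [map_add, hX, hY]
    | tmul x y =>
      simp only [LinearMap.lTensor_tmul, TensorProduct.rid_tmul, map_smul, LinearMap.rTensor_tmul]
      generalize comul (R := ℂ) x = Z
      induction Z using TensorProduct.induction_on with
      | zero => simp
      | add X Y hX hY => simp only [smul_add, TensorProduct.add_tmul, map_add, hX, hY]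
      | tmul u v => simp
  rw [starAct, key, coassoc_apply, ← LinearMap.comp_apply, ← LinearMap.lTensor_comp]
  rfl

/-- Both sides apply `φ` to the middle leg of the iterated coproduct. -/
theorem rTensor_starLin_comul (φ : Module.Dual ℂ A) (a : A) :
    (starLin φ).rTensor A (comul a) = (costarLin φ).lTensor A (comul a) := by
  have key : ∀ X : A ⊗[ℂ] A, (starLin φ).rTensor A X =
      ((TensorProduct.lid ℂ A).toLinearMap ∘ₗ φ.rTensor A).lTensor A
        (TensorProduct.assoc ℂ A A A ((comul (R := ℂ) (A := A)).rTensor A X)) := by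
    intro X
    induction X using TensorProduct.induction_on with
    | zero => simp
    | add X Y hX hY => simp only [map_add, hX, hY]
    | tmul x y =>
      simp only [LinearMap.rTensor_tmul, starLin_apply, starAct]
      generalize comul (R := ℂ) x = Z
      induction Z using TensorProduct.induction_on with
      | zero => simp
      | add X Y hX hY => simp only [TensorProduct.add_tmul, map_add, hX, hY]
      | tmul u v => simp [TensorProduct.smul_tmul]
  rw [key, coassoc_apply, ← LinearMap.comp_apply, ← LinearMap.lTensor_comp]
  rfl

/-- The left side is `S(a₍₁₎) a₍₂₎ φ(a₍₃₎)`. It yields both the formula for `P(dx)` and the bracket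
formula. -/
theorem antipode_mul_starAct (φ : Module.Dual ℂ A) (a : A) :
    LinearMap.mul' ℂ A (TensorProduct.map (antipode ℂ) (starLin φ) (comul a)) = φ a • 1 := by
  have key : ∀ X : A ⊗[ℂ] A, LinearMap.mul' ℂ A (TensorProduct.map (antipode ℂ) LinearMap.id
        (TensorProduct.rid ℂ (A ⊗[ℂ] A) (φ.lTensor _ ((comul (R := ℂ) (A := A)).rTensor A X)))) =
      φ (TensorProduct.lid ℂ A ((counit (R := ℂ) (A := A)).rTensor A X)) • 1 := by
    intro X
    induction X using TensorProduct.induction_on with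
    | zero => simp
    | add X Y hX hY => simp only [map_add, hX, hY, add_smul]
    | tmul x y =>
      have := mul_antipode_rTensor_comul_apply (R := ℂ) x
      rw [LinearMap.rTensor] at this
      simp [this, Algebra.algebraMap_eq_smul_one, smul_smul, mul_comm]
  have key2 : ∀ X : (A ⊗[ℂ] A) ⊗[ℂ] A, TensorProduct.rid ℂ (A ⊗[ℂ] A) (φ.lTensor _ X) =
      ((TensorProduct.rid ℂ A).toLinearMap ∘ₗ φ.lTensor A).lTensor A
        (TensorProduct.assoc ℂ A A A X) := by
    intro X
    induction X using TensorProduct.induction_on with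
    | zero => simp
    | add X Y hX hY => simp only [map_add, hX, hY]
    | tmul x y =>
      induction x using TensorProduct.induction_on with
      | zero => simp
      | add X Y hX hY => simp only [TensorProduct.add_tmul, map_add, hX, hY]
      | tmul u v => simp
  have := key (comul a)
  rw [key2, coassoc_apply, rTensor_counit_comul, TensorProduct.lid_tmul, one_smul] at this
  rw [← this, ← LinearMap.lTensor_comp_apply]
  simp only [LinearMap.lTensor, TensorProduct.map_map, LinearMap.id_comp, LinearMap.comp_id]
  rfl

variable {n : Type*} [Fintype n] [DecidableEq n]

/-- A matrix coefficient of a representation, as a functional. -/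
noncomputable def entry (ρ : A →ₐ[ℂ] Matrix n n ℂ) (i j : n) : Module.Dual ℂ A :=
  Matrix.entryLinearMap ℂ ℂ i j ∘ₗ ρ.toLinearMap

theorem entry_apply (ρ : A →ₐ[ℂ] Matrix n n ℂ) (i j : n) (a : A) : entry ρ i j a = ρ a i j := rfl

/-- The algebra map `a ↦ a₍₁₎ ρ(a₍₂₎)`. -/
noncomputable def starHom (ρ : A →ₐ[ℂ] Matrix n n ℂ) : A →ₐ[ℂ] Matrix n n A :=
  (matrixEquivTensor n ℂ A).symm.toAlgHom.comp
    ((Algebra.TensorProduct.map (AlgHom.id ℂ A) ρ).comp (Bialgebra.comulAlgHom ℂ A))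

/-- The algebra map `a ↦ ρ(a₍₁₎) a₍₂₎`. -/
noncomputable def costarHom (ρ : A →ₐ[ℂ] Matrix n n ℂ) : A →ₐ[ℂ] Matrix n n A :=
  (matrixEquivTensor n ℂ A).symm.toAlgHom.comp
    ((Algebra.TensorProduct.map (AlgHom.id ℂ A) ρ).comp
      ((Algebra.TensorProduct.comm ℂ A A).toAlgHom.comp (Bialgebra.comulAlgHom ℂ A)))

theorem starHom_apply (ρ : A →ₐ[ℂ] Matrix n n ℂ) (a : A) (i j : n) :
    starHom ρ a i j = starAct (entry ρ i j) a := by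
  have key : ∀ X : A ⊗[ℂ] A,
      (matrixEquivTensor n ℂ A).symm (Algebra.TensorProduct.map (AlgHom.id ℂ A) ρ X) i j =
      TensorProduct.rid ℂ A ((entry ρ i j).lTensor A X) := by
    intro X
    induction X using TensorProduct.induction_on with
    | zero => simp
    | add X Y hX hY => simp only [map_add, Matrix.add_apply, hX, hY]
    | tmul x y => simp [matrixEquivTensor_apply_symm, entry_apply, Algebra.smul_def,
        Algebra.commutes]
  exact key (comul a)

theorem costarHom_apply (ρ : A →ₐ[ℂ] Matrix n n ℂ) (a : A) (i j : n) :
    costarHom ρ a i j = costarLin (entry ρ i j) a := by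
  have key : ∀ X : A ⊗[ℂ] A,
      (matrixEquivTensor n ℂ A).symm (Algebra.TensorProduct.map (AlgHom.id ℂ A) ρ
        (Algebra.TensorProduct.comm ℂ A A X)) i j =
      TensorProduct.lid ℂ A ((entry ρ i j).rTensor A X) := by
    intro X
    induction X using TensorProduct.induction_on with
    | zero => simp
    | add X Y hX hY => simp only [map_add, Matrix.add_apply, hX, hY]
    | tmul x y => simp [matrixEquivTensor_apply_symm, entry_apply, Algebra.smul_def,
        Algebra.commutes]
  exact key (comul a)

end Regular

/-! ### The four-dimensional representation of the 3D calculus -/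

section Reference

open Coalgebra HopfAlgebra

variable {h : ℂ}

/-- The generators, arranged as a matrix. -/
def Gen.mat : Fin 2 → Fin 2 → Gen := ![![.a, .b], ![.c, .d]]

theorem Gen.exists_mat_eq (x : Gen) : ∃ p q, Gen.mat p q = x := by
  cases x
  exacts [⟨0, 0, rfl⟩, ⟨0, 1, rfl⟩, ⟨1, 0, rfl⟩, ⟨1, 1, rfl⟩]

theorem SL.comul_gen (i j : Fin 2) : comul (R := ℂ) (SL.gen h (Gen.mat i j)) =
    ∑ k, SL.gen h (Gen.mat i k) ⊗ₜ SL.gen h (Gen.mat k j) := by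
  rw [SL.comul_eq]
  fin_cases i <;> fin_cases j <;>
    simp [SL.comulHom, SL.lift_gen, SL.pick, Gen.mat, Fin.sum_univ_two]

theorem SL.counit_gen (i j : Fin 2) : counit (R := ℂ) (SL.gen h (Gen.mat i j)) =
    if i = j then 1 else 0 := by
  rw [SL.counit_eq]
  fin_cases i <;> fin_cases j <;> simp [SL.counitHom, SL.lift_gen, SL.pick, Gen.mat]

/-- The values of the commutation functionals on the generators. -/
def genF (h : ℂ) : Gen → Matrix (Fin 3) (Fin 3) ℂ
  | .a => !![1, 0, -h; 2 * h, 1, h ^ 2; 0, 0, 1]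
  | .b => !![0, 0, 2 * h ^ 2; 0, 2 * h, -2 * h ^ 3; 0, 0, -2 * h]
  | .c => 0
  | .d => !![1, 0, h; -2 * h, 1, -3 * h ^ 2; 0, 0, 1]

/-- The values on the generators of the basis of the quantum Lie algebra. -/
def genChi (h : ℂ) : Gen → Fin 3 → ℂ
  | .a => ![1, 0, 0]
  | .b => ![0, 1, 0]
  | .c => ![0, 0, 1]
  | .d => ![-1, 0, -2 * h]

/-- The values of the counit on the generators. -/
def genEps : Gen → ℂ := SL.pick 1 0 0 1

/-- The block matrix `!![f, 0; χ, ε]` at a generator. -/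
def refMat (h : ℂ) (x : Gen) : Matrix (Fin 3 ⊕ Unit) (Fin 3 ⊕ Unit) ℂ :=
  Matrix.fromBlocks (genF h x) 0 (Matrix.of fun _ => genChi h x) (Matrix.of fun _ _ => genEps x)

/-- The upper left block says that `f` respects the relations; the last row says that the Leibniz
rule is consistent with them. -/
theorem refMat_isPoint (h : ℂ) :
    IsPoint h (refMat h .a) (refMat h .b) (refMat h .c) (refMat h .d) := by
  constructor <;>
  · ext (i | i) (j | j) <;> try fin_cases i
    all_goals try fin_cases j
    all_goals
      simp [refMat, genF, genChi, genEps, SL.pick, Matrix.mul_apply, Fin.sum_univ_three]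
    all_goals grind

/-- The representation `x ↦ !![f(x), 0; χ(x), ε(x)]`. -/
noncomputable def rho (h : ℂ) : SL h →ₐ[ℂ] Matrix (Fin 3 ⊕ Unit) (Fin 3 ⊕ Unit) ℂ :=
  SL.lift (refMat_isPoint h)

theorem rho_gen (x : Gen) : rho h (SL.gen h x) = refMat h x := by
  rw [rho, SL.lift_gen]
  cases x <;> rfl

/-- The commutation functionals. -/
noncomputable def refF (h : ℂ) (i j : Fin 3) : Module.Dual ℂ (SL h) :=
  entry (rho h) (.inl i) (.inl j)

/-- The basis of the quantum Lie algebra. -/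
noncomputable def refChi (h : ℂ) (j : Fin 3) : Module.Dual ℂ (SL h) :=
  entry (rho h) (.inr ()) (.inl j)

/-- Block triangularity passes to products, which is what separates the rules for `f`, `χ` and the
counit. -/
theorem rho_inl_inr (x : SL h) (i : Fin 3) : rho h x (.inl i) (.inr ()) = 0 := by
  induction x using SL.induction generalizing i with
  | hs r => simp [Matrix.algebraMap_matrix_apply]
  | hg x => simp [rho_gen, refMat]
  | ha x y hx hy => simp [hx, hy]
  | hm x y hx hy => simp [Matrix.mul_apply, hx, hy]

theorem rho_inr_inr (x : SL h) : rho h x (.inr ()) (.inr ()) = counit (R := ℂ) x := by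
  induction x using SL.induction with
  | hs r => simp [Matrix.algebraMap_matrix_apply]
  | hg x =>
    rw [rho_gen, SL.counit_eq, SL.counitHom, SL.lift_gen]
    cases x <;> rfl
  | ha x y hx hy => simp [hx, hy]
  | hm x y hx hy => simp [Matrix.mul_apply, hx, hy, rho_inl_inr]

theorem refF_one (i j : Fin 3) : refF h i j 1 = if i = j then 1 else 0 := by
  simp [refF, entry_apply, Matrix.one_apply]

theorem refF_mul (i j : Fin 3) (x y : SL h) :
    refF h i j (x * y) = ∑ k, refF h i k x * refF h k j y := by
  simp [refF, entry_apply, Matrix.mul_apply, rho_inl_inr]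

theorem refF_gen (i j : Fin 3) (x : Gen) : refF h i j (SL.gen h x) = genF h x i j := by
  simp [refF, entry_apply, rho_gen, refMat]

theorem refChi_one (j : Fin 3) : refChi h j 1 = 0 := by
  simp [refChi, entry_apply]

theorem refChi_mul (j : Fin 3) (x y : SL h) :
    refChi h j (x * y) = ∑ k, refChi h k x * refF h k j y + counit (R := ℂ) x * refChi h j y := by
  simp [refF, refChi, entry_apply, Matrix.mul_apply, rho_inr_inr]

theorem refChi_gen (j : Fin 3) (x : Gen) : refChi h j (SL.gen h x) = genChi h x j := by
  simp [refChi, entry_apply, rho_gen, refMat]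

/-- The coefficients `vⱼᵢ`, as a function of the position of `θᵢ = P(d Tₚ_q)`. -/
noncomputable def refRow (h : ℂ) (p q : Fin 2) : Fin 3 → SL h :=
  let S := fun i j => SL.antipodeLin h (SL.gen h (Gen.mat i j))
  let T := fun i j => SL.gen h (Gen.mat i j)
  ![S p 0 * T 0 q - S p 1 * T 1 q, S p 0 * T 1 q, S p 1 * T 0 q - (2 * h) • (S p 1 * T 1 q)]

/-- The coaction matrix of the 3D calculus. -/
noncomputable def refV (h : ℂ) (j i : Fin 3) : SL h :=
  ![refRow h 0 0, refRow h 0 1, refRow h 1 0] i j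

/-- The coaction matrix of the 3D calculus, transposed and bordered by `1`. -/
noncomputable def refW (h : ℂ) : Matrix (Fin 3 ⊕ Unit) (Fin 3 ⊕ Unit) (SL h) :=
  Matrix.fromBlocks (Matrix.of fun i j => refV h j i) 0 0 1

theorem starHom_rho_gen (p q : Fin 2) (i j : Fin 3 ⊕ Unit) :
    starHom (rho h) (SL.gen h (Gen.mat p q)) i j =
      ∑ k, refMat h (Gen.mat k q) i j • SL.gen h (Gen.mat p k) := by
  rw [starHom_apply, starAct, SL.comul_gen]
  simp [entry_apply, rho_gen]

theorem costarHom_rho_gen (p q : Fin 2) (i j : Fin 3 ⊕ Unit) :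
    costarHom (rho h) (SL.gen h (Gen.mat p q)) i j =
      ∑ k, refMat h (Gen.mat p k) i j • SL.gen h (Gen.mat k q) := by
  rw [costarHom_apply, costarLin, LinearMap.comp_apply, LinearMap.comp_apply, SL.comul_gen]
  simp [entry_apply, rho_gen]

end Reference

/-! ### Right covariance: the coaction matrix as an intertwiner and as a corepresentation -/

section Compatibility

open Coalgebra HopfAlgebra

variable {h : ℂ}

-- A finite computation: every entry is brought to normally ordered words, `b` first, then powers of
-- only one of `a`, `d`, then `c`.
set_option maxHeartbeats 4000000 in
theorem starHom_mul_refW_gen (x : Gen) :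
    starHom (rho h) (SL.gen h x) * refW h = refW h * costarHom (rho h) (SL.gen h x) := by
  obtain ⟨p, q, rfl⟩ := Gen.exists_mat_eq x
  obtain ⟨ca, cd, db, ab, cb, da, ad⟩ := SL.isPoint (h := h)
  -- After reassociating to the right, a relation must also apply to two letters followed by a tail
  -- `x`.
  have ca' := fun x : SL h => congrArg (· * x) ca
  have cd' := fun x : SL h => congrArg (· * x) cd
  have db' := fun x : SL h => congrArg (· * x) db
  have ab' := fun x : SL h => congrArg (· * x) ab
  have cb' := fun x : SL h => congrArg (· * x) cb
  have da' := fun x : SL h => congrArg (· * x) da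
  have ad' := fun x : SL h => congrArg (· * x) ad
  simp only [add_mul, sub_mul, smul_mul_assoc, mul_assoc, one_mul] at ca' cd' db' ab' cb' da' ad'
  ext (i | i) (j | j)
  all_goals
    simp only [Matrix.mul_apply, Fintype.sum_sum_type, starHom_rho_gen, costarHom_rho_gen, refW,
      Matrix.fromBlocks_apply₁₁, Matrix.fromBlocks_apply₁₂, Matrix.fromBlocks_apply₂₁,
      Matrix.fromBlocks_apply₂₂, Matrix.of_apply, refMat, Fin.sum_univ_three, Fin.sum_univ_two,
      Finset.univ_unique, Finset.sum_singleton]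
    fin_cases p <;> fin_cases q <;> try fin_cases i
  all_goals try fin_cases j
  all_goals
    simp [refV, refRow, Gen.mat, SL.antipodeLin_gen, SL.pick, genF, genChi, genEps]
  all_goals
    simp only [mul_add, add_mul, mul_sub, sub_mul, mul_neg, neg_mul, smul_mul_assoc,
        mul_smul_comm, smul_add, smul_sub, smul_neg, mul_assoc, mul_one, one_mul,
        ca, cd, db, ab, cb, da, ad, ca', cd', db', ab', cb', da', ad']
    try module

theorem starHom_mul_refW (x : SL h) :
    starHom (rho h) x * refW h = refW h * costarHom (rho h) x := by
  induction x using SL.induction with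
  | hs r => rw [AlgHom.commutes, AlgHom.commutes, Algebra.commutes]
  | hg x => exact starHom_mul_refW_gen x
  | ha x y hx hy => rw [map_add, map_add, add_mul, mul_add, hx, hy]
  | hm x y hx hy => rw [map_mul, map_mul, mul_assoc, hy, ← mul_assoc, hx, mul_assoc]

/-- The upper left block of the intertwining identity: compatibility of the right coaction with
right multiplication. -/
theorem sum_starAct_refF_mul (i j : Fin 3) (x : SL h) :
    ∑ k, starAct (refF h i k) x * refV h j k = ∑ k, refV h k i * costarLin (refF h k j) x := by
  have := congrFun (congrFun (starHom_mul_refW x) (.inl i)) (.inl j)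
  simpa [Matrix.mul_apply, refW, starHom_apply, costarHom_apply, refF, refChi] using this

/-- The last row of the intertwining identity: right covariance of the differential, and the source
of both bracket formulas. -/
theorem sum_starAct_refChi_mul (j : Fin 3) (x : SL h) :
    ∑ k, starAct (refChi h k) x * refV h j k = costarLin (refChi h j) x := by
  have := congrFun (congrFun (starHom_mul_refW x) (.inr ())) (.inl j)
  simpa [Matrix.mul_apply, refW, starHom_apply, costarHom_apply, refF, refChi] using this

/-- Only position `(1, 1)` has content: the row attached to `d` must agree with the linear
dependence of `P(dd)` on `θ₁, θ₂, θ₃`. -/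
theorem refRow_eq (p q : Fin 2) (j : Fin 3) :
    refRow h p q j = ∑ i, genChi h (Gen.mat p q) i • refV h j i := by
  obtain ⟨ca, cd, db, ab, cb, da, ad⟩ := SL.isPoint (h := h)
  rw [Fin.sum_univ_three]
  fin_cases p <;> fin_cases q
  · simp [refV, genChi, Gen.mat]
  · simp [refV, genChi, Gen.mat]
  · simp [refV, genChi, Gen.mat]
  · fin_cases j
    all_goals
      simp [refV, genChi, Gen.mat, refRow, SL.antipodeLin_gen, SL.pick]
      simp only [add_mul, sub_mul, smul_mul_assoc, smul_add, smul_sub, smul_neg, ca, cd, ab, cb,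
        da, ad]
      module

/-- Both sides reverse products, so it is enough to compare them on generators. -/
theorem SL.comul_antipode (x : SL h) : comul (R := ℂ) (antipode ℂ x) =
    TensorProduct.map (antipode ℂ) (antipode ℂ) (TensorProduct.comm ℂ _ _ (comul (R := ℂ) x)) := by
  induction x using SL.induction with
  | hs r =>
    simp [Algebra.algebraMap_eq_smul_one, Algebra.TensorProduct.one_def]
  | ha x y hx hy => simp only [map_add, hx, hy]
  | hm x y hx hy =>
    rw [antipode_mul_antidistrib, Bialgebra.comul_mul, Bialgebra.comul_mul, hx, hy]
    generalize comul (R := ℂ) x = X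
    generalize comul (R := ℂ) y = Y
    induction X using TensorProduct.induction_on with
    | zero => simp
    | add X Z hX hZ => simp only [map_add, add_mul, mul_add, hX, hZ]
    | tmul u v =>
      induction Y using TensorProduct.induction_on with
      | zero => simp
      | add X Z hX hZ => simp only [map_add, add_mul, mul_add, hX, hZ]
      | tmul s t => simp [antipode_mul_antidistrib]
  | hg x =>
    have (x : SL h) : antipode ℂ x = SL.antipodeLin h x := rfl
    obtain ⟨p, q, rfl⟩ := Gen.exists_mat_eq x
    rw [SL.comul_gen]
    have g := SL.comul_gen (h := h)
    have ga := g 0 0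
    have gb := g 0 1
    have gc := g 1 0
    have gd := g 1 1
    simp only [Fin.sum_univ_two, Gen.mat, Matrix.cons_val_zero, Matrix.cons_val_one,
      Matrix.cons_val_fin_one] at ga gb gc gd
    simp only [Fin.sum_univ_two, map_add, TensorProduct.comm_tmul, TensorProduct.map_tmul, this]
    fin_cases p <;> fin_cases q <;>
    · simp [Gen.mat, SL.antipodeLin_gen, SL.pick, ga, gb, gc, gd, TensorProduct.add_tmul,
        TensorProduct.tmul_add, TensorProduct.sub_tmul, TensorProduct.tmul_sub,
        TensorProduct.neg_tmul, TensorProduct.tmul_neg, ← TensorProduct.smul_tmul']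
      try module

theorem SL.comul_antipode_gen (p q : Fin 2) :
    comul (R := ℂ) (antipode ℂ (SL.gen h (Gen.mat p q))) =
      ∑ k, antipode ℂ (SL.gen h (Gen.mat k q)) ⊗ₜ antipode ℂ (SL.gen h (Gen.mat p k)) := by
  rw [SL.comul_antipode, SL.comul_gen]
  simp

/-- The row is `∑ₖₗ χⱼ(Tₖₗ) S(Tₚₖ) Tₗ_q`, and the products `S(Tₚₖ) Tₗ_q` are matrix coefficients of
a corepresentation. -/
theorem comul_refRow (p q : Fin 2) (j : Fin 3) : comul (R := ℂ) (refRow h p q j) =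
    ∑ m, ∑ n, refRow h m n j ⊗ₜ
      (antipode ℂ (SL.gen h (Gen.mat p m)) * SL.gen h (Gen.mat n q)) := by
  have hS (x : SL h) : SL.antipodeLin h x = antipode ℂ x := rfl
  have key (k l : Fin 2) :
      comul (R := ℂ) (antipode ℂ (SL.gen h (Gen.mat p k)) * SL.gen h (Gen.mat l q)) =
      ∑ m, ∑ n, (antipode ℂ (SL.gen h (Gen.mat m k)) * SL.gen h (Gen.mat l n)) ⊗ₜ
        (antipode ℂ (SL.gen h (Gen.mat p m)) * SL.gen h (Gen.mat n q)) := by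
    rw [Bialgebra.comul_mul, SL.comul_antipode_gen, SL.comul_gen, Finset.sum_mul_sum]
    simp
  fin_cases j <;>
  · simp [refRow, hS, key, TensorProduct.sub_tmul, ← TensorProduct.smul_tmul', Fin.sum_univ_two]
    try module

theorem comul_refV (i j : Fin 3) :
    comul (R := ℂ) (refV h j i) = ∑ k, refV h j k ⊗ₜ refV h k i := by
  have hS (x : SL h) : SL.antipodeLin h x = antipode ℂ x := rfl
  have key (p q : Fin 2) : comul (R := ℂ) (refRow h p q j) =
      ∑ k, refV h j k ⊗ₜ refRow h p q k := by
    rw [comul_refRow]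
    simp only [refRow_eq _ _ j, Fin.sum_univ_two, Fin.sum_univ_three]
    simp [genChi, Gen.mat, refRow, hS, TensorProduct.tmul_sub, TensorProduct.add_tmul,
      TensorProduct.neg_tmul, ← TensorProduct.smul_tmul']
    module
  fin_cases i
  · exact key 0 0
  · exact key 0 1
  · exact key 1 0

theorem counit_refV (i j : Fin 3) : counit (R := ℂ) (refV h j i) = if i = j then 1 else 0 := by
  have hS (x : SL h) : SL.antipodeLin h x = antipode ℂ x := rfl
  fin_cases i <;> fin_cases j <;> simp [refV, refRow, hS, SL.counit_gen]

end Compatibility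

/-! ### Construction of the 3D calculus -/

section Construction

open Coalgebra HopfAlgebra

/-- The 1-forms of the 3D calculus: coefficients with respect to the basis `θ₁, θ₂, θ₃`. -/
def Forms (h : ℂ) : Type := Fin 3 → SL h

variable {h : ℂ}

noncomputable instance : AddCommGroup (Forms h) := inferInstanceAs (AddCommGroup (Fin 3 → SL h))

noncomputable instance : Module ℂ (Forms h) := inferInstanceAs (Module ℂ (Fin 3 → SL h))

noncomputable instance : Module (SL h) (Forms h) := inferInstanceAs (Module (SL h) (Fin 3 → SL h))

/-- The commutation homomorphism `x ↦ (fᵢⱼ ⋆ x)`. -/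
noncomputable def commMat (x : SL h) : Matrix (Fin 3) (Fin 3) (SL h) :=
  Matrix.of fun i j => starAct (refF h i j) x

theorem commMat_apply (x : SL h) (i j : Fin 3) : commMat x i j = starAct (refF h i j) x := rfl

/-- Through this block form, multiplicativity of `starHom (rho h)` gives both the right action and
the Leibniz rule. -/
theorem starHom_rho_eq (x : SL h) : starHom (rho h) x =
    Matrix.fromBlocks (commMat x) 0 (Matrix.of fun _ j => starAct (refChi h j) x)
      (Matrix.of fun _ _ => x) := by
  ext (i | i) (j | j)
  · rw [starHom_apply]; rfl
  · have : entry (rho h) (.inl i) (.inr j) = 0 := by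
      ext x
      exact rho_inl_inr x i
    rw [starHom_apply, starAct, this]
    simp
  · rw [starHom_apply]; rfl
  · have : entry (rho h) (.inr i) (.inr j) = counit (R := ℂ) := by
      ext x
      exact rho_inr_inr x
    rw [starHom_apply, starAct, this]
    simp

theorem commMat_one : commMat (1 : SL h) = 1 := by
  have := starHom_rho_eq (1 : SL h)
  rw [map_one, ← Matrix.fromBlocks_one, Matrix.fromBlocks_inj] at this
  exact this.1.symm

theorem commMat_add (x y : SL h) : commMat (x + y) = commMat x + commMat y := by
  ext i j
  simp [commMat, starAct]

theorem commMat_zero : commMat (0 : SL h) = 0 := by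
  ext i j
  simp [commMat, starAct]

theorem commMat_mul (x y : SL h) : commMat (x * y) = commMat x * commMat y := by
  have := map_mul (starHom (rho h)) x y
  rw [starHom_rho_eq, starHom_rho_eq, starHom_rho_eq, Matrix.fromBlocks_multiply,
    Matrix.fromBlocks_inj] at this
  simpa using this.1

theorem starAct_refChi_mul (j : Fin 3) (x y : SL h) : starAct (refChi h j) (x * y) =
    ∑ k, starAct (refChi h k) x * commMat y k j + x * starAct (refChi h j) y := by
  have := map_mul (starHom (rho h)) x y
  rw [starHom_rho_eq, starHom_rho_eq, starHom_rho_eq, Matrix.fromBlocks_multiply,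
    Matrix.fromBlocks_inj] at this
  simpa [Matrix.mul_apply] using congrFun (congrFun this.2.2.1 ()) j

noncomputable instance : Module (SL h)ᵐᵒᵖ (Forms h) where
  smul b ω := Matrix.vecMul ω (commMat b.unop)
  one_smul ω := (congrArg (Matrix.vecMul (ω : Fin 3 → SL h)) commMat_one).trans
    (Matrix.vecMul_one _)
  mul_smul b b' ω := (congrArg (Matrix.vecMul (ω : Fin 3 → SL h)) (commMat_mul _ _)).trans
    (Matrix.vecMul_vecMul _ _ _).symm
  smul_zero b := Matrix.zero_vecMul _
  smul_add b ω ω' := Matrix.add_vecMul _ _ _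
  add_smul b b' ω := (congrArg (Matrix.vecMul (ω : Fin 3 → SL h)) (commMat_add _ _)).trans
    (Matrix.vecMul_add _ _ _)
  zero_smul ω := (congrArg (Matrix.vecMul (ω : Fin 3 → SL h)) commMat_zero).trans
    (Matrix.vecMul_zero _)

namespace Forms

theorem op_smul_apply (x : SL h) (ω : Forms h) (j : Fin 3) :
    (MulOpposite.op x • ω) j = ∑ i, ω i * starAct (refF h i j) x := rfl

theorem smul_apply (x : SL h) (ω : Forms h) (j : Fin 3) : (x • ω) j = x * ω j := rfl

theorem add_apply (ω ω' : Forms h) (j : Fin 3) : (ω + ω') j = ω j + ω' j := rfl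

theorem csmul_apply (r : ℂ) (ω : Forms h) (j : Fin 3) : (r • ω) j = r • ω j := rfl

@[ext]
theorem ext {ω ω' : Forms h} (H : ∀ i, ω i = ω' i) : ω = ω' := funext H

instance : SMulCommClass (SL h) (SL h)ᵐᵒᵖ (Forms h) where
  smul_comm a b ω := by
    ext j
    obtain ⟨b, rfl⟩ := MulOpposite.op_surjective b
    simp only [smul_apply, op_smul_apply, Finset.mul_sum, mul_assoc]

instance : IsScalarTower ℂ (SL h) (Forms h) :=
  inferInstanceAs (IsScalarTower ℂ (SL h) (Fin 3 → SL h))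

instance : IsScalarTower ℂ (SL h)ᵐᵒᵖ (Forms h) where
  smul_assoc r b ω := by
    ext j
    obtain ⟨b, rfl⟩ := MulOpposite.op_surjective b
    rw [← MulOpposite.op_smul]
    simp only [op_smul_apply, csmul_apply, ← starLin_apply, map_smul, Finset.smul_sum,
      mul_smul_comm]

/-- The map `x ↦ x θᵢ`. -/
noncomputable def single (i : Fin 3) : SL h →ₗ[ℂ] Forms h := LinearMap.single ℂ (fun _ => SL h) i

theorem single_apply (i j : Fin 3) (x : SL h) :
    single i x j = if j = i then x else 0 := by
  change (Pi.single i x : Fin 3 → SL h) j = _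
  rw [Pi.single_apply]

theorem smul_single (x y : SL h) (i : Fin 3) : x • single i y = single i (x * y) := by
  ext j
  simp only [smul_apply, single_apply, mul_ite, mul_zero]

theorem op_smul_single (x y : SL h) (i : Fin 3) :
    MulOpposite.op y • single i x = ∑ j, single j (x * starAct (refF h i j) y) := by
  ext k
  simp only [op_smul_apply, single_apply, ite_mul, zero_mul, Finset.sum_ite_eq', Finset.mem_univ,
    if_true]
  have (s : Fin 3 → Forms h) : (∑ j, s j) k = ∑ j, s j k := Finset.sum_apply k _ s
  rw [this]
  simp [single_apply]

theorem sum_single (ω : Forms h) : ∑ i, single i (ω i) = ω := by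
  ext k
  have (s : Fin 3 → Forms h) : (∑ j, s j) k = ∑ j, s j k := Finset.sum_apply k _ s
  rw [this, Finset.sum_eq_single k] <;> simp +contextual [single_apply, eq_comm]

theorem induction_single {p : Forms h → Prop} (ha : ∀ ω ω', p ω → p ω' → p (ω + ω'))
    (hs : ∀ i x, p (single i x)) (ω : Forms h) : p ω := by
  rw [← sum_single ω, Fin.sum_univ_three]
  exact ha _ _ (ha _ _ (hs _ _) (hs _ _)) (hs _ _)

/-- A coordinate of a form. -/
noncomputable def coord (i : Fin 3) : Forms h →ₗ[ℂ] SL h := LinearMap.proj (φ := fun _ => SL h) i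

theorem coord_apply (i : Fin 3) (ω : Forms h) : coord i ω = ω i := rfl

/-- The left coaction. -/
noncomputable def coactL : Forms h →ₗ[ℂ] SL h ⊗[ℂ] Forms h :=
  ∑ i, (single i).lTensor (SL h) ∘ₗ comul ∘ₗ coord i

/-- The right coaction. -/
noncomputable def coactR : Forms h →ₗ[ℂ] Forms h ⊗[ℂ] SL h :=
  ∑ i, ∑ j, (single j).rTensor (SL h) ∘ₗ LinearMap.mulRight ℂ (1 ⊗ₜ refV h j i) ∘ₗ
    comul ∘ₗ coord i

theorem coactL_apply (ω : Forms h) :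
    coactL ω = ∑ i, (single i).lTensor (SL h) (comul (R := ℂ) (ω i)) := by
  simp [coactL, coord_apply]

theorem coactL_single (i : Fin 3) (x : SL h) :
    coactL (single i x) = (single i).lTensor (SL h) (comul (R := ℂ) x) := by
  rw [coactL_apply, Finset.sum_eq_single i] <;> simp +contextual [single_apply]

theorem coactR_apply (ω : Forms h) : coactR ω =
    ∑ i, ∑ j, (single j).rTensor (SL h) (comul (R := ℂ) (ω i) * (1 ⊗ₜ refV h j i)) := by
  simp [coactR, coord_apply]

theorem coactR_single (i : Fin 3) (x : SL h) : coactR (single i x) =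
    ∑ j, (single j).rTensor (SL h) (comul (R := ℂ) x * (1 ⊗ₜ refV h j i)) := by
  rw [coactR_apply, Finset.sum_eq_single i] <;> simp +contextual [single_apply]

/-- The differential. -/
noncomputable def diff : SL h →ₗ[ℂ] Forms h := ∑ i, single i ∘ₗ starLin (refChi h i)

theorem diff_eq (x : SL h) : diff x = ∑ i, single i (starAct (refChi h i) x) := by
  simp [diff, starLin_apply]

theorem diff_apply (x : SL h) (i : Fin 3) : diff x i = starAct (refChi h i) x := by
  rw [diff_eq]
  have (s : Fin 3 → Forms h) : (∑ j, s j) i = ∑ j, s j i := Finset.sum_apply i _ s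
  rw [this]
  simp [single_apply]

theorem lactAΓ_single (X Y : SL h ⊗[ℂ] SL h) (i : Fin 3) :
    lactAΓ (SL h) (Forms h) X ((single i).lTensor (SL h) Y) = (single i).lTensor (SL h) (X * Y) := by
  induction X using TensorProduct.induction_on with
  | zero => simp
  | add X Z hX hZ => simp only [map_add, add_mul, LinearMap.add_apply, hX, hZ]
  | tmul u v =>
    induction Y using TensorProduct.induction_on with
    | zero => simp
    | add X Z hX hZ => simp only [map_add, mul_add, hX, hZ]
    | tmul s t => simp [lactAΓ, lact, smul_single]

theorem lactΓA_single (X Y : SL h ⊗[ℂ] SL h) (i : Fin 3) :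
    lactΓA (SL h) (Forms h) X ((single i).rTensor (SL h) Y) = (single i).rTensor (SL h) (X * Y) := by
  induction X using TensorProduct.induction_on with
  | zero => simp
  | add X Z hX hZ => simp only [map_add, add_mul, LinearMap.add_apply, hX, hZ]
  | tmul u v =>
    induction Y using TensorProduct.induction_on with
    | zero => simp
    | add X Z hX hZ => simp only [map_add, mul_add, hX, hZ]
    | tmul s t => simp [lactΓA, lact, smul_single]

theorem ractAΓ_single (X Y : SL h ⊗[ℂ] SL h) (i : Fin 3) :
    ractAΓ (SL h) (Forms h) X ((single i).lTensor (SL h) Y) =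
      ∑ j, (single j).lTensor (SL h) (Y * (starLin (refF h i j)).lTensor (SL h) X) := by
  induction X using TensorProduct.induction_on with
  | zero => simp
  | add X Z hX hZ => simp only [map_add, mul_add, LinearMap.add_apply, hX, hZ,
      Finset.sum_add_distrib]
  | tmul u v =>
    induction Y using TensorProduct.induction_on with
    | zero => simp
    | add X Z hX hZ => simp only [map_add, add_mul, hX, hZ, Finset.sum_add_distrib]
    | tmul s t => simp [ractAΓ, ract, op_smul_single, TensorProduct.tmul_sum, starLin_apply]

theorem ractΓA_single (X Y : SL h ⊗[ℂ] SL h) (i : Fin 3) :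
    ractΓA (SL h) (Forms h) X ((single i).rTensor (SL h) Y) =
      ∑ j, (single j).rTensor (SL h) (Y * (starLin (refF h i j)).rTensor (SL h) X) := by
  induction X using TensorProduct.induction_on with
  | zero => simp
  | add X Z hX hZ => simp only [map_add, mul_add, LinearMap.add_apply, hX, hZ,
      Finset.sum_add_distrib]
  | tmul u v =>
    induction Y using TensorProduct.induction_on with
    | zero => simp
    | add X Z hX hZ => simp only [map_add, add_mul, hX, hZ, Finset.sum_add_distrib]
    | tmul s t => simp [ractΓA, ract, op_smul_single, TensorProduct.sum_tmul, starLin_apply]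

end Forms

end Construction

/-! ### The bicovariance axioms, the differential and the left-invariant forms of the constructed
calculus -/

section Construction

open Coalgebra HopfAlgebra

variable {h : ℂ}

namespace Forms

theorem coassocL (ω : Forms h) :
    TensorProduct.assoc ℂ _ _ _ ((comul (R := ℂ) (A := SL h)).rTensor (Forms h) (coactL ω)) =
      coactL.lTensor (SL h) (coactL ω) := by
  induction ω using induction_single with
  | ha ω ω' hω hω' => simp only [map_add, hω, hω']
  | hs i x =>
    rw [coactL_single]
    have h₁ : ∀ X : SL h ⊗[ℂ] SL h,
        TensorProduct.assoc ℂ _ _ _ ((comul (R := ℂ) (A := SL h)).rTensor (Forms h)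
          ((single i).lTensor (SL h) X)) = ((single i).lTensor (SL h)).lTensor (SL h)
            (TensorProduct.assoc ℂ _ _ _ ((comul (R := ℂ) (A := SL h)).rTensor (SL h) X)) := by
      intro X
      induction X using TensorProduct.induction_on with
      | zero => simp
      | add X Y hX hY => simp only [map_add, hX, hY]
      | tmul u v =>
        simp only [LinearMap.lTensor_tmul, LinearMap.rTensor_tmul]
        generalize comul (R := ℂ) u = Z
        induction Z using TensorProduct.induction_on with
        | zero => simp
        | add X Y hX hY => simp only [TensorProduct.add_tmul, map_add, hX, hY]
        | tmul s t => simp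
    rw [h₁, coassoc_apply, ← LinearMap.lTensor_comp_apply, ← LinearMap.lTensor_comp_apply]
    congr 2
    ext x : 1
    exact (coactL_single i x).symm

theorem counitL (ω : Forms h) :
    TensorProduct.lid ℂ _ ((counit (R := ℂ) (A := SL h)).rTensor (Forms h) (coactL ω)) = ω := by
  induction ω using induction_single with
  | ha ω ω' hω hω' => simp only [map_add, hω, hω']
  | hs i x =>
    have h₁ : ∀ X : SL h ⊗[ℂ] SL h,
        TensorProduct.lid ℂ _ ((counit (R := ℂ) (A := SL h)).rTensor (Forms h)
          ((single i).lTensor (SL h) X)) = single i (TensorProduct.lid ℂ _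
            ((counit (R := ℂ) (A := SL h)).rTensor (SL h) X)) := by
      intro X
      induction X using TensorProduct.induction_on with
      | zero => simp
      | add X Y hX hY => simp only [map_add, hX, hY]
      | tmul u v => simp
    rw [coactL_single, h₁, rTensor_counit_comul, TensorProduct.lid_tmul, one_smul]

theorem counitR (ω : Forms h) :
    TensorProduct.rid ℂ _ ((counit (R := ℂ) (A := SL h)).lTensor (Forms h) (coactR ω)) = ω := by
  induction ω using induction_single with
  | ha ω ω' hω hω' => simp only [map_add, hω, hω']
  | hs i x =>
    have h₁ : ∀ (j : Fin 3) (X : SL h ⊗[ℂ] SL h),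
        TensorProduct.rid ℂ _ ((counit (R := ℂ) (A := SL h)).lTensor (Forms h)
          ((single j).rTensor (SL h) (X * (1 ⊗ₜ refV h j i)))) = if i = j then
            single j (TensorProduct.rid ℂ _
            ((counit (R := ℂ) (A := SL h)).lTensor (SL h) X)) else 0 := by
      intro j X
      induction X using TensorProduct.induction_on with
      | zero => simp
      | add X Y hX hY =>
        simp only [map_add, add_mul, hX, hY]
        split_ifs <;> simp
      | tmul u v => simp [counit_refV]
    rw [coactR_single, map_sum, map_sum]
    simp only [h₁]
    rw [Finset.sum_ite_eq, if_pos (Finset.mem_univ _), lTensor_counit_comul,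
      TensorProduct.rid_tmul, one_smul]

theorem coassocR (ω : Forms h) :
    TensorProduct.assoc ℂ _ _ _ (coactR.rTensor (SL h) (coactR ω)) =
      (comul (R := ℂ) (A := SL h)).lTensor (Forms h) (coactR ω) := by
  induction ω using induction_single with
  | ha ω ω' hω hω' => simp only [map_add, hω, hω']
  | hs i x =>
    have h₁ : ∀ (j : Fin 3) (X : SL h ⊗[ℂ] SL h),
        TensorProduct.assoc ℂ _ _ _ (coactR.rTensor (SL h)
          ((single j).rTensor (SL h) (X * (1 ⊗ₜ refV h j i)))) =
        ∑ k, (single k).rTensor (SL h ⊗[ℂ] SL h)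
            (TensorProduct.assoc ℂ _ _ _ ((comul (R := ℂ) (A := SL h)).rTensor (SL h) X) *
              (1 ⊗ₜ (refV h k j ⊗ₜ refV h j i))) := by
      intro j X
      induction X using TensorProduct.induction_on with
      | zero => simp
      | add X Y hX hY => simp only [map_add, add_mul, hX, hY, Finset.sum_add_distrib]
      | tmul u v =>
        simp only [Algebra.TensorProduct.tmul_mul_tmul, LinearMap.rTensor_tmul, mul_one,
          coactR_single, TensorProduct.sum_tmul, map_sum]
        refine Finset.sum_congr rfl fun k _ => ?_
        generalize comul (R := ℂ) u = Z
        induction Z using TensorProduct.induction_on with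
        | zero => simp
        | add X Y hX hY => simp only [TensorProduct.add_tmul, map_add, add_mul, hX, hY]
        | tmul s t => simp
    have h₂ : ∀ (k : Fin 3) (X : SL h ⊗[ℂ] SL h),
        (comul (R := ℂ) (A := SL h)).lTensor (Forms h)
          ((single k).rTensor (SL h) (X * (1 ⊗ₜ refV h k i))) =
        ∑ j, (single k).rTensor (SL h ⊗[ℂ] SL h)
            ((comul (R := ℂ) (A := SL h)).lTensor (SL h) X *
              (1 ⊗ₜ (refV h k j ⊗ₜ refV h j i))) := by
      intro j X
      induction X using TensorProduct.induction_on with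
      | zero => simp
      | add X Y hX hY => simp only [map_add, add_mul, hX, hY, Finset.sum_add_distrib]
      | tmul u v =>
        simp [comul_refV, Finset.mul_sum, TensorProduct.tmul_sum]
    rw [coactR_single, map_sum, map_sum, map_sum]
    simp only [h₁, h₂, coassoc_apply]
    exact Finset.sum_comm

theorem coactL_coactR (ω : Forms h) :
    TensorProduct.assoc ℂ _ _ _ (coactL.rTensor (SL h) (coactR ω)) =
      coactR.lTensor (SL h) (coactL ω) := by
  induction ω using induction_single with
  | ha ω ω' hω hω' => simp only [map_add, hω, hω']
  | hs i x =>
    have h₁ : ∀ (j : Fin 3) (X : SL h ⊗[ℂ] SL h),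
        TensorProduct.assoc ℂ _ _ _ (coactL.rTensor (SL h)
          ((single j).rTensor (SL h) (X * (1 ⊗ₜ refV h j i)))) =
        ((single j).rTensor (SL h)).lTensor (SL h)
            (TensorProduct.assoc ℂ _ _ _ ((comul (R := ℂ) (A := SL h)).rTensor (SL h) X) *
              (1 ⊗ₜ (1 ⊗ₜ refV h j i))) := by
      intro j X
      induction X using TensorProduct.induction_on with
      | zero => simp
      | add X Y hX hY => simp only [map_add, add_mul, hX, hY]
      | tmul u v =>
        simp only [Algebra.TensorProduct.tmul_mul_tmul, LinearMap.rTensor_tmul, mul_one,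
          coactL_single]
        generalize comul (R := ℂ) u = Z
        induction Z using TensorProduct.induction_on with
        | zero => simp
        | add X Y hX hY => simp only [TensorProduct.add_tmul, map_add, add_mul, hX, hY]
        | tmul s t => simp
    have h₂ : ∀ X : SL h ⊗[ℂ] SL h,
        coactR.lTensor (SL h) ((single i).lTensor (SL h) X) =
        ∑ j, ((single j).rTensor (SL h)).lTensor (SL h)
            ((comul (R := ℂ) (A := SL h)).lTensor (SL h) X *
              (1 ⊗ₜ (1 ⊗ₜ refV h j i))) := by
      intro X
      induction X using TensorProduct.induction_on with
      | zero => simp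
      | add X Y hX hY => simp only [map_add, add_mul, hX, hY, Finset.sum_add_distrib]
      | tmul u v => simp [coactR_single, TensorProduct.tmul_sum]
    rw [coactR_single, map_sum, map_sum, coactL_single, h₂]
    simp only [h₁, coassoc_apply]

theorem coactL_lsmul (a : SL h) (ω : Forms h) :
    coactL (a • ω) = lactAΓ (SL h) (Forms h) (comul a) (coactL ω) := by
  induction ω using induction_single with
  | ha ω ω' hω hω' => simp only [smul_add, map_add, hω, hω']
  | hs i x => rw [smul_single, coactL_single, coactL_single, lactAΓ_single, Bialgebra.comul_mul]

theorem coactL_rsmul (b : SL h) (ω : Forms h) :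
    coactL (MulOpposite.op b • ω) = ractAΓ (SL h) (Forms h) (comul b) (coactL ω) := by
  induction ω using induction_single with
  | ha ω ω' hω hω' => simp only [smul_add, map_add, hω, hω']
  | hs i x =>
    simp only [op_smul_single, map_sum, coactL_single, ractAΓ_single, Bialgebra.comul_mul,
      comul_starAct]

theorem coactR_lsmul (a : SL h) (ω : Forms h) :
    coactR (a • ω) = lactΓA (SL h) (Forms h) (comul a) (coactR ω) := by
  induction ω using induction_single with
  | ha ω ω' hω hω' => simp only [smul_add, map_add, hω, hω']
  | hs i x =>
    simp only [smul_single, coactR_single, map_sum, lactΓA_single, Bialgebra.comul_mul, mul_assoc]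

/-- On `x θᵢ`, moving the functionals to the second leg reduces the claim to `sum_starAct_refF_mul`
applied in that leg. -/
theorem coactR_rsmul (b : SL h) (ω : Forms h) :
    coactR (MulOpposite.op b • ω) = ractΓA (SL h) (Forms h) (comul b) (coactR ω) := by
  induction ω using induction_single with
  | ha ω ω' hω hω' => simp only [smul_add, map_add, hω, hω']
  | hs i x =>
    have key (k : Fin 3) (X : SL h ⊗[ℂ] SL h) :
        ∑ j, (starLin (refF h i j)).lTensor (SL h) X * (1 ⊗ₜ refV h k j) =
        ∑ j, (1 ⊗ₜ refV h j i) * (costarLin (refF h j k)).lTensor (SL h) X := by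
      induction X using TensorProduct.induction_on with
      | zero => simp
      | add X Y hX hY => simp only [map_add, add_mul, mul_add, Finset.sum_add_distrib, hX, hY]
      | tmul u v =>
        simp [starLin_apply, ← TensorProduct.tmul_sum, sum_starAct_refF_mul]
    simp only [op_smul_single, map_sum, coactR_single, ractΓA_single, Bialgebra.comul_mul,
      comul_starAct, rTensor_starLin_comul]
    rw [Finset.sum_comm]
    conv_rhs => rw [Finset.sum_comm]
    refine Finset.sum_congr rfl fun k _ => ?_
    rw [← map_sum, ← map_sum]
    simp only [mul_assoc]
    rw [← Finset.mul_sum, ← Finset.mul_sum, key]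

theorem leibniz (a b : SL h) : diff (a * b) = MulOpposite.op b • diff a + a • diff b := by
  ext j
  rw [add_apply, smul_apply, op_smul_apply]
  simp only [diff_apply, starAct_refChi_mul, commMat_apply]

theorem lTensor_diff (X : SL h ⊗[ℂ] SL h) : diff.lTensor (SL h) X =
    ∑ i, (single i).lTensor (SL h) ((starLin (refChi h i)).lTensor (SL h) X) := by
  induction X using TensorProduct.induction_on with
  | zero => simp
  | add X Y hX hY => simp only [map_add, Finset.sum_add_distrib, hX, hY]
  | tmul u v => simp [diff_eq, TensorProduct.tmul_sum, starLin_apply]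

theorem rTensor_diff (X : SL h ⊗[ℂ] SL h) : diff.rTensor (SL h) X =
    ∑ i, (single i).rTensor (SL h) ((starLin (refChi h i)).rTensor (SL h) X) := by
  induction X using TensorProduct.induction_on with
  | zero => simp
  | add X Y hX hY => simp only [map_add, Finset.sum_add_distrib, hX, hY]
  | tmul u v => simp [diff_eq, TensorProduct.sum_tmul, starLin_apply]

theorem coactL_diff (a : SL h) : coactL (diff a) = diff.lTensor (SL h) (comul (R := ℂ) a) := by
  rw [coactL_apply]
  simp only [diff_apply, comul_starAct, lTensor_diff]

theorem coactR_diff (a : SL h) : coactR (diff a) = diff.rTensor (SL h) (comul (R := ℂ) a) := by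
  have key (k : Fin 3) (X : SL h ⊗[ℂ] SL h) :
      ∑ j, (starLin (refChi h j)).lTensor (SL h) X * (1 ⊗ₜ refV h k j) =
      (costarLin (refChi h k)).lTensor (SL h) X := by
    induction X using TensorProduct.induction_on with
    | zero => simp
    | add X Y hX hY => simp only [map_add, add_mul, Finset.sum_add_distrib, hX, hY]
    | tmul u v => simp [starLin_apply, ← TensorProduct.tmul_sum, sum_starAct_refChi_mul]
  rw [coactR_apply]
  simp only [diff_apply, comul_starAct]
  rw [Finset.sum_comm, rTensor_diff]
  refine Finset.sum_congr rfl fun k _ => ?_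
  rw [← map_sum, key, rTensor_starLin_comul]

/-- This is `P(dx) = ∑ᵢ χᵢ(x) θᵢ`, stated before `P` is available because `span_diff` needs it to
build the calculus. -/
theorem lift_antipode_diff (x : SL h) :
    TensorProduct.lift (lact (SL h) (Forms h) ∘ₗ antipode ℂ)
      (diff.lTensor (SL h) (comul (R := ℂ) x)) = ∑ i, refChi h i x • single i 1 := by
  have key (i : Fin 3) (X : SL h ⊗[ℂ] SL h) :
      TensorProduct.lift (lact (SL h) (Forms h) ∘ₗ antipode ℂ) ((single i).lTensor (SL h) X) =
      single i (LinearMap.mul' ℂ _ (TensorProduct.map (antipode ℂ) LinearMap.id X)) := by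
    induction X using TensorProduct.induction_on with
    | zero => simp
    | add X Y hX hY => simp only [map_add, hX, hY]
    | tmul u v => simp [lact, smul_single]
  rw [lTensor_diff, map_sum]
  refine Finset.sum_congr rfl fun i _ => ?_
  rw [key, LinearMap.lTensor, TensorProduct.map_map, LinearMap.id_comp, LinearMap.comp_id,
    antipode_mul_starAct, map_smul]

theorem sum_refChi_gen_smul (i : Fin 3) :
    ∑ j, refChi h j (SL.gen h (![.a, .b, .c] i)) • single j 1 = (single i 1 : Forms h) := by
  fin_cases i <;> simp [refChi_gen, genChi, Fin.sum_univ_three]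

theorem span_diff :
    Submodule.span ℂ {ω : Forms h | ∃ a b : SL h, ω = a • diff b} = ⊤ := by
  set N := Submodule.span ℂ {ω : Forms h | ∃ a b : SL h, ω = a • diff b}
  have smul_mem (a : SL h) {ω : Forms h} (hω : ω ∈ N) : a • ω ∈ N := by
    induction hω using Submodule.span_induction with
    | mem ω hω =>
      obtain ⟨b, c, rfl⟩ := hω
      rw [← mul_smul]
      exact Submodule.subset_span ⟨_, _, rfl⟩
    | zero => rw [smul_zero]; exact zero_mem _
    | add ω ω' _ _ hω hω' => rw [smul_add]; exact add_mem hω hω'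
    | smul r ω _ hω => rw [smul_comm]; exact N.smul_mem r hω
  have lift_mem (X : SL h ⊗[ℂ] SL h) :
      TensorProduct.lift (lact (SL h) (Forms h) ∘ₗ antipode ℂ) (diff.lTensor (SL h) X) ∈ N := by
    induction X using TensorProduct.induction_on with
    | zero => simp
    | add X Y hX hY => simpa only [map_add] using add_mem hX hY
    | tmul u v => exact Submodule.subset_span ⟨_, _, rfl⟩
  rw [eq_top_iff]
  rintro ω -
  rw [← sum_single ω]
  refine sum_mem fun i _ => ?_
  -- For `x` the `i`-th of `a, b, c`, the form `S(x₍₁₎) dx₍₂₎` is `θᵢ`, because the `χⱼ` are dual to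
  -- these generators.
  have := smul_mem (ω i) (lift_mem (comul (R := ℂ) (SL.gen h (![.a, .b, .c] i))))
  rwa [lift_antipode_diff, sum_refChi_gen_smul, smul_single, mul_one] at this

/-- The 3D calculus. -/
noncomputable def calculus (h : ℂ) : BicovariantCalculus (SL h) (Forms h) where
  d := diff
  leibniz := leibniz
  span_d := span_diff
  coactL := coactL
  coactR := coactR
  coassocL := coassocL
  counitL := counitL
  coassocR := coassocR
  counitR := counitR
  coactL_coactR := coactL_coactR
  coactL_lsmul := coactL_lsmul
  coactL_rsmul := coactL_rsmul
  coactR_lsmul := coactR_lsmul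
  coactR_rsmul := coactR_rsmul
  coactL_d := coactL_diff
  coactR_d := coactR_diff

theorem theta_calculus (i : Fin 3) : theta (calculus h) i = single i 1 := by
  have key (x : SL h) : (calculus h).proj ((calculus h).d x) = ∑ i, refChi h i x • single i 1 := by
    rw [← lift_antipode_diff, ← coactL_diff]
    rfl
  rw [← sum_refChi_gen_smul, ← key]
  fin_cases i <;> rfl

theorem isThreeDim_calculus : IsThreeDim (calculus h) := by
  have hθ : theta (calculus h) = fun i => single i 1 := funext theta_calculus
  rw [IsThreeDim, hθ]
  constructor
  · rw [Fintype.linearIndependent_iff]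
    intro g hg i
    have := congrArg (fun ω => counit (R := ℂ) (coord i ω)) hg
    simp only [map_zero] at this
    simpa [coord_apply, single_apply, apply_ite] using this
  · apply le_antisymm
    · rw [Submodule.span_le]
      rintro _ ⟨i, rfl⟩
      change coactL (single i 1) = 1 ⊗ₜ single i 1
      rw [coactL_single, Bialgebra.comul_one, Algebra.TensorProduct.one_def,
        LinearMap.lTensor_tmul]
    · intro ω hω
      have hω : coactL ω = 1 ⊗ₜ ω := hω
      rw [← sum_single ω]
      refine sum_mem fun i _ => ?_
      -- Invariance thus reads `Δ(ωᵢ) = 1 ⊗ ωᵢ`; the counit on the second leg shows that `ωᵢ` is a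
      -- scalar.
      have key : (coord i).lTensor (SL h) (coactL ω) = comul (R := ℂ) (ω i) := by
        rw [coactL_apply, map_sum, Finset.sum_eq_single i]
        · rw [← LinearMap.lTensor_comp_apply]
          have : coord i ∘ₗ single i = (LinearMap.id : SL h →ₗ[ℂ] SL h) := by
            ext x
            simp [coord_apply, single_apply]
          rw [this, LinearMap.lTensor_id, LinearMap.id_apply]
        · intro j _ hj
          rw [← LinearMap.lTensor_comp_apply]
          have : coord i ∘ₗ single j = (0 : SL h →ₗ[ℂ] SL h) := by
            ext x
            simp [coord_apply, single_apply, hj.symm]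
          rw [this, LinearMap.lTensor_zero, LinearMap.zero_apply]
        · simp
      have h₂ := congrArg (fun X => TensorProduct.rid ℂ _
        ((counit (R := ℂ) (A := SL h)).lTensor _ X)) key
      rw [hω] at h₂
      simp only [LinearMap.lTensor_tmul, coord_apply, lTensor_counit_comul,
        TensorProduct.rid_tmul, one_smul] at h₂
      rw [← h₂, map_smul]
      exact Submodule.smul_mem _ _ (Submodule.subset_span ⟨i, rfl⟩)

end Forms

end Construction

/-! ### Bicovariant calculi over `SL_h(2)`: left-invariant forms and coordinates -/

section LeftInvariant

open Coalgebra HopfAlgebra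

variable {h : ℂ} {Γ : Type*} [AddCommGroup Γ] [Module ℂ Γ] [Module (SL h) Γ]
  [Module (SL h)ᵐᵒᵖ Γ] [SMulCommClass (SL h) (SL h)ᵐᵒᵖ Γ] [IsScalarTower ℂ (SL h) Γ]
  [IsScalarTower ℂ (SL h)ᵐᵒᵖ Γ]

/-- `Δ(S(x₍₁₎)) (x₍₂₎ ⊗ 1) = S(x₍₂₎) x₍₃₎ ⊗ S(x₍₁₎)`, and the first leg collapses. It is the reason
`P(ω)` is left-invariant. -/
theorem SL.comul_antipode_mul (x : SL h) :
    TensorProduct.lift ((LinearMap.mul ℂ (SL h ⊗[ℂ] SL h)).compl₁₂ (comul ∘ₗ antipode ℂ)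
      ((TensorProduct.mk ℂ (SL h) (SL h)).flip 1)) (comul (R := ℂ) x) = 1 ⊗ₜ antipode ℂ x := by
  have h₁ : ∀ X : SL h ⊗[ℂ] SL h,
      TensorProduct.lift ((LinearMap.mul ℂ (SL h ⊗[ℂ] SL h)).compl₁₂ (comul ∘ₗ antipode ℂ)
        ((TensorProduct.mk ℂ (SL h) (SL h)).flip 1)) X =
      TensorProduct.comm ℂ _ _ (TensorProduct.map (antipode ℂ)
        (LinearMap.mul' ℂ (SL h) ∘ₗ (antipode ℂ).rTensor (SL h)) (TensorProduct.assoc ℂ _ _ _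
        ((comul (R := ℂ) (A := SL h)).rTensor (SL h) X))) := by
    intro X
    induction X using TensorProduct.induction_on with
    | zero => simp
    | add X Y hX hY => simp only [map_add, hX, hY]
    | tmul u v =>
      simp only [TensorProduct.lift.tmul, LinearMap.compl₁₂_apply, LinearMap.comp_apply,
        SL.comul_antipode, LinearMap.rTensor_tmul]
      generalize comul (R := ℂ) u = Z
      induction Z using TensorProduct.induction_on with
      | zero => simp
      | add X Y hX hY => simp only [TensorProduct.add_tmul, map_add, LinearMap.add_apply, hX, hY]
      | tmul s t => simp
  have h₂ : ∀ X : SL h ⊗[ℂ] SL h, TensorProduct.map (antipode ℂ)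
        (LinearMap.mul' ℂ (SL h) ∘ₗ (antipode ℂ).rTensor (SL h))
        ((comul (R := ℂ) (A := SL h)).lTensor (SL h) X) =
      antipode ℂ (TensorProduct.rid ℂ _ ((counit (R := ℂ) (A := SL h)).lTensor (SL h) X)) ⊗ₜ 1 := by
    intro X
    induction X using TensorProduct.induction_on with
    | zero => simp
    | add X Y hX hY => simp only [map_add, TensorProduct.add_tmul, hX, hY]
    | tmul u v =>
      simp [mul_antipode_rTensor_comul_apply, Algebra.algebraMap_eq_smul_one,
        TensorProduct.smul_tmul']
  rw [h₁, coassoc_apply, h₂, lTensor_counit_comul]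
  simp

namespace BicovariantCalculus

variable (C : BicovariantCalculus (SL h) Γ)

/-- `S(a₍₁₎ x) a₍₂₎ = S(x) S(a₍₁₎) a₍₂₎ = ε(a) S(x)`. -/
theorem proj_smul (a : SL h) (ω : Γ) : C.proj (a • ω) = counit (R := ℂ) a • C.proj ω := by
  have h₁ : ∀ (x : SL h) (ω : Γ) (X : SL h ⊗[ℂ] SL h),
      TensorProduct.lift (lact (SL h) Γ ∘ₗ antipode ℂ) (lactAΓ (SL h) Γ X (x ⊗ₜ ω)) =
      antipode ℂ x • (LinearMap.mul' ℂ _ ((antipode ℂ).rTensor _ X)) • ω := by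
    intro x ω X
    induction X using TensorProduct.induction_on with
    | zero => simp
    | add X Y hX hY => simp only [map_add, LinearMap.add_apply, hX, hY, add_smul, smul_add]
    | tmul u v => simp [lactAΓ, lact, antipode_mul_antidistrib, mul_smul]
  have h₂ : ∀ Z : SL h ⊗[ℂ] Γ,
      TensorProduct.lift (lact (SL h) Γ ∘ₗ antipode ℂ) (lactAΓ (SL h) Γ (comul a) Z) =
      counit (R := ℂ) a • TensorProduct.lift (lact (SL h) Γ ∘ₗ antipode ℂ) Z := by
    intro Z
    induction Z using TensorProduct.induction_on with
    | zero => simp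
    | add X Y hX hY => simp only [map_add, hX, hY, smul_add]
    | tmul x ω =>
      rw [h₁, mul_antipode_rTensor_comul_apply, algebraMap_smul, smul_comm]
      rfl
  rw [proj, LinearMap.comp_apply, LinearMap.comp_apply, C.coactL_lsmul, h₂]

theorem coactL_proj (ω : Γ) : C.coactL (C.proj ω) = 1 ⊗ₜ C.proj ω := by
  set H : SL h ⊗[ℂ] (SL h ⊗[ℂ] Γ) →ₗ[ℂ] SL h ⊗[ℂ] Γ :=
    TensorProduct.lift (lactAΓ (SL h) Γ ∘ₗ comul ∘ₗ antipode ℂ) with hH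
  have h₁ : ∀ Z : SL h ⊗[ℂ] Γ,
      C.coactL (TensorProduct.lift (lact (SL h) Γ ∘ₗ antipode ℂ) Z) =
      H (C.coactL.lTensor (SL h) Z) := by
    intro Z
    induction Z using TensorProduct.induction_on with
    | zero => simp
    | add X Y hX hY => simp only [map_add, hX, hY]
    | tmul x ω => simp [hH, lact, C.coactL_lsmul]
  have h₂ : ∀ (ω : Γ) (X : SL h ⊗[ℂ] SL h), H (TensorProduct.assoc ℂ _ _ _ (X ⊗ₜ ω)) =
      ((LinearMap.toSpanSingleton (SL h) Γ ω).restrictScalars ℂ).lTensor (SL h)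
        (TensorProduct.lift ((LinearMap.mul ℂ (SL h ⊗[ℂ] SL h)).compl₁₂ (comul ∘ₗ antipode ℂ)
          ((TensorProduct.mk ℂ (SL h) (SL h)).flip 1)) X) := by
    intro ω X
    induction X using TensorProduct.induction_on with
    | zero => simp
    | add X Y hX hY => simp only [TensorProduct.add_tmul, map_add, hX, hY]
    | tmul u v =>
      simp only [hH, TensorProduct.assoc_tmul, TensorProduct.lift.tmul, LinearMap.comp_apply,
        LinearMap.compl₁₂_apply]
      generalize comul (R := ℂ) (antipode ℂ u) = Z
      induction Z using TensorProduct.induction_on with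
      | zero => simp
      | add X Y hX hY => simp only [map_add, LinearMap.add_apply, hX, hY]
      | tmul s t => simp [lactAΓ, lact]
  have h₃ : ∀ Z : SL h ⊗[ℂ] Γ,
      H (TensorProduct.assoc ℂ _ _ _ ((comul (R := ℂ) (A := SL h)).rTensor Γ Z)) =
      1 ⊗ₜ TensorProduct.lift (lact (SL h) Γ ∘ₗ antipode ℂ) Z := by
    intro Z
    induction Z using TensorProduct.induction_on with
    | zero => simp
    | add X Y hX hY => simp only [map_add, hX, hY, TensorProduct.tmul_add]
    | tmul x ω =>
      rw [LinearMap.rTensor_tmul, h₂, SL.comul_antipode_mul]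
      simp [lact]
  rw [proj, LinearMap.comp_apply, h₁, ← C.coassocL, h₃]

theorem proj_mem_leftInvariant (ω : Γ) : C.proj ω ∈ C.leftInvariant := C.coactL_proj ω

theorem proj_of_mem_leftInvariant {ω : Γ} (hω : ω ∈ C.leftInvariant) : C.proj ω = ω := by
  have hω : C.coactL ω = 1 ⊗ₜ ω := hω
  rw [proj, LinearMap.comp_apply, hω]
  simp [lact]

/-- `ω = ω₍A₎ P(ω₍Γ₎)`, by `x₍₁₎ S(x₍₂₎) = ε(x)`: left-invariant forms generate `Γ` as a left
module. -/
theorem lift_lact_proj (ω : Γ) :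
    TensorProduct.lift (lact (SL h) Γ) (C.proj.lTensor (SL h) (C.coactL ω)) = ω := by
  set N : SL h ⊗[ℂ] (SL h ⊗[ℂ] Γ) →ₗ[ℂ] Γ := TensorProduct.lift (lact (SL h) Γ) ∘ₗ
    (TensorProduct.lift (lact (SL h) Γ ∘ₗ antipode ℂ)).lTensor (SL h) with hN
  have h₁ : ∀ Z : SL h ⊗[ℂ] Γ,
      TensorProduct.lift (lact (SL h) Γ) (C.proj.lTensor (SL h) Z) =
      N (C.coactL.lTensor (SL h) Z) := by
    intro Z
    rw [hN, LinearMap.comp_apply, ← LinearMap.lTensor_comp_apply]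
    rfl
  have h₂ : ∀ (ω : Γ) (X : SL h ⊗[ℂ] SL h), N (TensorProduct.assoc ℂ _ _ _ (X ⊗ₜ ω)) =
      LinearMap.mul' ℂ _ ((antipode ℂ).lTensor _ X) • ω := by
    intro ω X
    induction X using TensorProduct.induction_on with
    | zero => simp
    | add X Y hX hY => simp only [TensorProduct.add_tmul, map_add, hX, hY, add_smul]
    | tmul u v => simp [hN, lact, mul_smul]
  have h₃ : ∀ Z : SL h ⊗[ℂ] Γ,
      N (TensorProduct.assoc ℂ _ _ _ ((comul (R := ℂ) (A := SL h)).rTensor Γ Z)) =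
      TensorProduct.lid ℂ _ ((counit (R := ℂ) (A := SL h)).rTensor Γ Z) := by
    intro Z
    induction Z using TensorProduct.induction_on with
    | zero => simp
    | add X Y hX hY => simp only [map_add, hX, hY]
    | tmul x ω =>
      rw [LinearMap.rTensor_tmul, h₂, mul_antipode_lTensor_comul_apply, algebraMap_smul]
      simp
  rw [h₁, ← C.coassocL, h₃, C.counitL]

theorem proj_d_gen (p q : Fin 2) : C.proj (C.d (SL.gen h (Gen.mat p q))) =
    ∑ k, antipode ℂ (SL.gen h (Gen.mat p k)) • C.d (SL.gen h (Gen.mat k q)) := by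
  rw [proj, LinearMap.comp_apply, C.coactL_d, SL.comul_gen]
  simp [lact]

/-- Valid in every bicovariant calculus: the four forms `P(dTₚ_q)` transform under the adjoint
corepresentation, whatever linear relations they satisfy. -/
theorem coactR_proj_d_gen (p q : Fin 2) : C.coactR (C.proj (C.d (SL.gen h (Gen.mat p q)))) =
    ∑ k, ∑ l, C.proj (C.d (SL.gen h (Gen.mat k l))) ⊗ₜ
      (antipode ℂ (SL.gen h (Gen.mat p k)) * SL.gen h (Gen.mat l q)) := by
  have h₁ (k : Fin 2) : C.coactR (antipode ℂ (SL.gen h (Gen.mat p k)) •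
      C.d (SL.gen h (Gen.mat k q))) = ∑ m, ∑ l,
      (antipode ℂ (SL.gen h (Gen.mat m k)) • C.d (SL.gen h (Gen.mat k l))) ⊗ₜ
      (antipode ℂ (SL.gen h (Gen.mat p m)) * SL.gen h (Gen.mat l q)) := by
    rw [C.coactR_lsmul, C.coactR_d, SL.comul_antipode_gen, SL.comul_gen]
    simp [lactΓA, lact]
  simp only [proj_d_gen, TensorProduct.sum_tmul]
  rw [map_sum]
  simp only [h₁]
  rw [Finset.sum_comm]
  refine Finset.sum_congr rfl fun m _ => ?_
  rw [Finset.sum_comm]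

/-- Coordinate functionals `cᵢ` of a 3D calculus: `P(ω) = ∑ᵢ cᵢ(ω) θᵢ`. -/
structure IsCoord (c : Fin 3 → Γ →ₗ[ℂ] ℂ) : Prop where
  proj_eq : ∀ ω, C.proj ω = ∑ i, c i ω • theta C i
  smul : ∀ i (a : SL h) ω, c i (a • ω) = counit (R := ℂ) a * c i ω
  theta : ∀ i j, c i (theta C j) = if i = j then 1 else 0

theorem exists_isCoord (hC : IsThreeDim C) : ∃ c, C.IsCoord c := by
  obtain ⟨hli, hsp⟩ := hC
  have hmem (ω : Γ) : C.proj ω ∈ Submodule.span ℂ (Set.range (theta C)) :=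
    hsp ▸ C.proj_mem_leftInvariant ω
  set b := Module.Basis.span hli with hb
  have hbθ (i : Fin 3) : (b i : Γ) = theta C i :=
    congrArg Subtype.val (Module.Basis.span_apply hli i)
  have hproj (j : Fin 3) : C.proj (theta C j) = theta C j :=
    C.proj_of_mem_leftInvariant (hsp ▸ Submodule.subset_span ⟨j, rfl⟩)
  refine ⟨fun i => b.coord i ∘ₗ C.proj.codRestrict _ hmem, ⟨fun ω => ?_, fun i a ω => ?_,
    fun i j => ?_⟩⟩
  · have := congrArg Subtype.val (b.sum_repr (C.proj.codRestrict _ hmem ω))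
    simp only [AddSubmonoidClass.coe_finsetSum, Submodule.coe_smul, hbθ] at this
    exact this.symm
  · have : C.proj.codRestrict _ hmem (a • ω) =
        counit (R := ℂ) a • C.proj.codRestrict _ hmem ω :=
      Subtype.ext (C.proj_smul a ω)
    simp only [LinearMap.comp_apply, this, map_smul, smul_eq_mul]
  · have : C.proj.codRestrict _ hmem (theta C j) = b j := Subtype.ext ((hproj j).trans (hbθ j).symm)
    rw [LinearMap.comp_apply, this]
    simp [Finsupp.single_apply, eq_comm]

end BicovariantCalculus

end LeftInvariant

/-! ### Functionals and structure equations of an arbitrary 3D calculus -/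

section Coordinates

open Coalgebra HopfAlgebra

variable {h : ℂ} {Γ : Type*} [AddCommGroup Γ] [Module ℂ Γ] [Module (SL h) Γ]
  [Module (SL h)ᵐᵒᵖ Γ] [SMulCommClass (SL h) (SL h)ᵐᵒᵖ Γ] [IsScalarTower ℂ (SL h) Γ]
  [IsScalarTower ℂ (SL h)ᵐᵒᵖ Γ]

theorem coactL_theta (C : BicovariantCalculus (SL h) Γ) (i : Fin 3) :
    C.coactL (theta C i) = 1 ⊗ₜ theta C i := by
  fin_cases i <;> exact C.coactL_proj _

/-- The functionals `x ↦ cⱼ(θᵢ x)`. -/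
noncomputable def coordF (C : BicovariantCalculus (SL h) Γ) (c : Fin 3 → Γ →ₗ[ℂ] ℂ) (i j : Fin 3) :
    Module.Dual ℂ (SL h) :=
  c j ∘ₗ (ract (SL h) Γ).flip (theta C i)

theorem coordF_apply (C : BicovariantCalculus (SL h) Γ) (c : Fin 3 → Γ →ₗ[ℂ] ℂ) (i j : Fin 3)
    (x : SL h) : coordF C c i j x = c j (MulOpposite.op x • theta C i) := rfl

/-- The functionals `x ↦ cⱼ(dx)`. -/
noncomputable def coordChi (C : BicovariantCalculus (SL h) Γ) (c : Fin 3 → Γ →ₗ[ℂ] ℂ) (j : Fin 3) :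
    Module.Dual ℂ (SL h) :=
  c j ∘ₗ C.d

theorem coordChi_apply (C : BicovariantCalculus (SL h) Γ) (c : Fin 3 → Γ →ₗ[ℂ] ℂ) (j : Fin 3)
    (x : SL h) : coordChi C c j x = c j (C.d x) := rfl

namespace BicovariantCalculus.IsCoord

variable {C : BicovariantCalculus (SL h) Γ} {c : Fin 3 → Γ →ₗ[ℂ] ℂ}

theorem proj_apply (hc : C.IsCoord c) (i : Fin 3) (ω : Γ) : c i (C.proj ω) = c i ω := by
  have h₁ : ∀ Z : SL h ⊗[ℂ] Γ, c i (TensorProduct.lift (lact (SL h) Γ ∘ₗ antipode ℂ) Z) =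
      c i (TensorProduct.lid ℂ _ ((counit (R := ℂ) (A := SL h)).rTensor Γ Z)) := by
    intro Z
    induction Z using TensorProduct.induction_on with
    | zero => simp
    | add X Y hX hY => simp only [map_add, hX, hY]
    | tmul x ω => simp [lact, hc.smul]
  rw [proj, LinearMap.comp_apply, h₁, C.counitL]

/-- Insert the expansion of `P` in the `θᵢ` into `ω = ω₍A₎ P(ω₍Γ₎)`. -/
theorem eq_sum (hc : C.IsCoord c) (ω : Γ) :
    ω = ∑ i, TensorProduct.rid ℂ _ ((c i).lTensor (SL h) (C.coactL ω)) •
      JordanianSL2.theta C i := by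
  have h₁ : ∀ Z : SL h ⊗[ℂ] Γ,
      TensorProduct.lift (lact (SL h) Γ) (C.proj.lTensor (SL h) Z) =
      ∑ i, TensorProduct.rid ℂ _ ((c i).lTensor (SL h) Z) • JordanianSL2.theta C i := by
    intro Z
    induction Z using TensorProduct.induction_on with
    | zero => simp
    | add X Y hX hY => simp only [map_add, hX, hY, add_smul, Finset.sum_add_distrib]
    | tmul x ω =>
      simp only [LinearMap.lTensor_tmul, TensorProduct.lift.tmul, hc.proj_eq, map_sum,
        TensorProduct.rid_tmul]
      refine Finset.sum_congr rfl fun i _ => ?_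
      rw [map_smul, smul_assoc]
      rfl
  rw [← h₁, C.lift_lact_proj]

theorem counit_coef (i : Fin 3) (ω : Γ) :
    counit (R := ℂ) (TensorProduct.rid ℂ _ ((c i).lTensor (SL h) (C.coactL ω))) = c i ω := by
  have h₁ : ∀ Z : SL h ⊗[ℂ] Γ,
      counit (R := ℂ) (TensorProduct.rid ℂ _ ((c i).lTensor (SL h) Z)) =
      c i (TensorProduct.lid ℂ _ ((counit (R := ℂ) (A := SL h)).rTensor Γ Z)) := by
    intro Z
    induction Z using TensorProduct.induction_on with
    | zero => simp
    | add X Y hX hY => simp only [map_add, hX, hY]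
    | tmul x ω => simp [mul_comm]
  rw [h₁, C.counitL]

/-- Expand `ω` over the `θᵢ`; right multiplication passes the left coefficients, and `cⱼ` sees only
their counits. The product rules of `f` and `χ` follow. -/
theorem op_smul (hc : C.IsCoord c) (j : Fin 3) (y : SL h) (ω : Γ) :
    c j (MulOpposite.op y • ω) = ∑ i, c i ω * coordF C c i j y := by
  conv_lhs => rw [hc.eq_sum ω]
  simp only [Finset.smul_sum, map_sum, coordF_apply]
  refine Finset.sum_congr rfl fun i _ => ?_
  rw [← smul_comm, hc.smul, counit_coef]

theorem isCommutation (hc : C.IsCoord c) :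
    IsCommutation (JordanianSL2.theta C) (coordF C c) := by
  intro i a
  have h₁ (j : Fin 3) (X : SL h ⊗[ℂ] SL h) : TensorProduct.rid ℂ _ ((c j).lTensor (SL h)
      (ractAΓ (SL h) Γ X (1 ⊗ₜ JordanianSL2.theta C i))) =
      TensorProduct.rid ℂ _ ((coordF C c i j).lTensor (SL h) X) := by
    induction X using TensorProduct.induction_on with
    | zero => simp
    | add X Y hX hY => simp only [map_add, LinearMap.add_apply, hX, hY]
    | tmul x y => simp [ractAΓ, coordF]
  conv_lhs => rw [hc.eq_sum (MulOpposite.op a • JordanianSL2.theta C i)]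
  rw [C.coactL_rsmul, coactL_theta]
  simp only [h₁, starAct]

theorem commutation_unique (hc : C.IsCoord c) {f : Fin 3 → Fin 3 → Module.Dual ℂ (SL h)}
    (hf : IsCommutation (JordanianSL2.theta C) f) : f = coordF C c := by
  funext i j
  ext a
  rw [coordF_apply, hf i a]
  simp [hc.smul, hc.theta, counit_starAct]

theorem coordF_one (hc : C.IsCoord c) (i j : Fin 3) : coordF C c i j 1 = if i = j then 1 else 0 := by
  rw [coordF_apply, MulOpposite.op_one, one_smul, hc.theta]
  simp only [eq_comm]

theorem coordF_mul (hc : C.IsCoord c) (i j : Fin 3) (x y : SL h) :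
    coordF C c i j (x * y) = ∑ k, coordF C c i k x * coordF C c k j y := by
  rw [coordF_apply, MulOpposite.op_mul, mul_smul, hc.op_smul]
  rfl

theorem coordChi_mul (hc : C.IsCoord c) (j : Fin 3) (x y : SL h) : coordChi C c j (x * y) =
    ∑ k, coordChi C c k x * coordF C c k j y + counit (R := ℂ) x * coordChi C c j y := by
  rw [coordChi_apply, C.leibniz, map_add, hc.op_smul, hc.smul]
  rfl

theorem coordChi_one (_hc : C.IsCoord c) (j : Fin 3) : coordChi C c j 1 = 0 := by
  have h₁ := C.leibniz 1 1
  rw [mul_one, MulOpposite.op_one, one_smul, one_smul, left_eq_add] at h₁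
  rw [coordChi_apply, h₁, map_zero]

theorem coordChi_gen (hc : C.IsCoord c) (i j : Fin 3) :
    coordChi C c j (SL.gen h (![.a, .b, .c] i)) = if i = j then 1 else 0 := by
  rw [coordChi_apply, ← hc.proj_apply]
  have : C.proj (C.d (SL.gen h (![.a, .b, .c] i))) = JordanianSL2.theta C i := by
    fin_cases i <;> rfl
  rw [this, hc.theta]
  simp only [eq_comm]

/-- Applying `cⱼ` to the left leg of `Γ ⊗ A`, on a product with `X`. -/
theorem contract_lactΓA (hc : C.IsCoord c) (j : Fin 3) (X : SL h ⊗[ℂ] SL h) (ω : Γ) (v : SL h) :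
    TensorProduct.lid ℂ _ ((c j).rTensor (SL h) (lactΓA (SL h) Γ X (ω ⊗ₜ v))) =
      c j ω • (TensorProduct.lid ℂ _ ((counit (R := ℂ) (A := SL h)).rTensor (SL h) X) * v) := by
  induction X using TensorProduct.induction_on with
  | zero => simp
  | add X Y hX hY => simp only [map_add, LinearMap.add_apply, hX, hY, add_mul, smul_add]
  | tmul x y => simp [lactΓA, lact, hc.smul, smul_smul, mul_comm]

theorem contract_ractΓA (j i : Fin 3) (X : SL h ⊗[ℂ] SL h) (v : SL h) :
    TensorProduct.lid ℂ _ ((c j).rTensor (SL h)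
      (ractΓA (SL h) Γ X (JordanianSL2.theta C i ⊗ₜ v))) =
      v * TensorProduct.lid ℂ _ ((coordF C c i j).rTensor (SL h) X) := by
  induction X using TensorProduct.induction_on with
  | zero => simp
  | add X Y hX hY => simp only [map_add, LinearMap.add_apply, hX, hY, mul_add]
  | tmul x y => simp [ractΓA, coordF]

theorem contract_coactR (hc : C.IsCoord c) {v : Fin 3 → Fin 3 → SL h}
    (hv : C.IsCoactionMatrix (JordanianSL2.theta C) v) (i j : Fin 3) :
    TensorProduct.lid ℂ _ ((c j).rTensor (SL h) (C.coactR (JordanianSL2.theta C i))) = v j i := by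
  rw [hv i]
  simp [hc.theta]

theorem coactionMatrix_unique (hc : C.IsCoord c) {v v' : Fin 3 → Fin 3 → SL h}
    (hv : C.IsCoactionMatrix (JordanianSL2.theta C) v)
    (hv' : C.IsCoactionMatrix (JordanianSL2.theta C) v') : v = v' := by
  funext j i
  rw [← hc.contract_coactR hv, hc.contract_coactR hv']

/-- Compute `Δ_R(θᵢ x)` before and after commuting `x` to the left, then apply `cⱼ` to the form leg.
-/
theorem sum_starAct_coordF_mul (hc : C.IsCoord c) {v : Fin 3 → Fin 3 → SL h}
    (hv : C.IsCoactionMatrix (JordanianSL2.theta C) v) (i j : Fin 3) (x : SL h) :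
    ∑ k, starAct (coordF C c i k) x * v j k = ∑ k, v k i * costarLin (coordF C c k j) x := by
  have h₁ := congrArg (fun Z => TensorProduct.lid ℂ _ ((c j).rTensor (SL h) Z))
    (C.coactR_rsmul x (JordanianSL2.theta C i))
  rw [hc.isCommutation i x, hv i] at h₁
  simp only [map_sum, contract_ractΓA, C.coactR_lsmul] at h₁
  simp only [hv _, map_sum, hc.contract_lactΓA, hc.theta, rTensor_counit_comul] at h₁
  simpa [costarLin] using h₁

end BicovariantCalculus.IsCoord

end Coordinates

/-! ### The values of the functionals on the coaction matrix -/

section Tables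

open Coalgebra HopfAlgebra

variable {h : ℂ}

/-- The values `fₛₖ(vⱼᵢ)`. -/
def tableF (h : ℂ) : Fin 3 → Fin 3 → Fin 3 → Fin 3 → ℂ :=
  ![![![![1, 0, 0], ![0, 1, 0], ![0, 0, 1]],
      ![![0, 0, 0], ![0, 4 * h, 0], ![0, 0, -4 * h]],
      ![![0, 0, 0], ![0, 0, 0], ![0, 0, 0]]],
    ![![![0, 0, 0], ![0, 0, 0], ![0, 0, 0]],
      ![![1, 0, 2 * h], ![-4 * h, 1, -8 * h ^ 2], ![0, 0, 1]],
      ![![0, 0, 0], ![0, 0, 0], ![0, 0, 0]]],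
    ![![![0, 0, 0], ![-8 * h ^ 2, -2 * h, 0], ![0, 0, 2 * h]],
      ![![0, 0, 0], ![0, 0, 0], ![0, 0, -8 * h ^ 2]],
      ![![1, 0, -2 * h], ![4 * h, 1, 0], ![0, 0, 1]]]]

/-- The values `χₖ(vⱼᵢ)`. -/
def tableChi (h : ℂ) : Fin 3 → Fin 3 → Fin 3 → ℂ :=
  ![![![0, 0, 0], ![0, 2, 0], ![0, 0, -2]],
    ![![0, 0, 1], ![-2, 0, -4 * h], ![0, 0, 0]],
    ![![-4 * h, -1, 0], ![0, 0, 0], ![2, 0, -4 * h]]]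

set_option maxHeartbeats 4000000 in
theorem refF_refV (s k j i : Fin 3) : refF h s k (refV h j i) = tableF h j i s k := by
  fin_cases i <;> fin_cases j <;>
    simp [refV, refRow, refF_mul, SL.antipodeLin_gen, SL.pick, refF_gen, Fin.sum_univ_three, tableF,
      Gen.mat] <;>
    fin_cases s <;> fin_cases k <;> simp [genF]
  all_goals grind

set_option maxHeartbeats 4000000 in
theorem refChi_refV (k j i : Fin 3) : refChi h k (refV h j i) = tableChi h j i k := by
  have hε : ∀ x : Gen, counit (R := ℂ) (SL.gen h x) = genEps x := by
    intro x
    rw [SL.counit_eq, SL.counitHom, SL.lift_gen]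
    rfl
  fin_cases i <;> fin_cases j <;>
    simp [refV, refRow, refChi_mul, SL.antipodeLin_gen, SL.pick, refF_gen, refChi_gen,
      Fin.sum_univ_three, tableChi, Gen.mat, hε, genEps] <;>
    fin_cases k <;> simp [genF, genChi]
  all_goals grind

end Tables

/-! ### Uniqueness of the 3D calculus -/

section Uniqueness

open Coalgebra HopfAlgebra

variable {h : ℂ} {Γ : Type*} [AddCommGroup Γ] [Module ℂ Γ] [Module (SL h) Γ]
  [Module (SL h)ᵐᵒᵖ Γ] [SMulCommClass (SL h) (SL h)ᵐᵒᵖ Γ] [IsScalarTower ℂ (SL h) Γ]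
  [IsScalarTower ℂ (SL h)ᵐᵒᵖ Γ]

theorem SL.counit_gen_eq (x : Gen) : counit (R := ℂ) (SL.gen h x) = genEps x := by
  rw [SL.counit_eq, SL.counitHom, SL.lift_gen]
  rfl

/-- The values on the generators of commutation functionals are determined by the Leibniz rule
on the defining relations and the compatibility with the right coaction. -/
theorem eq_genF {f : Gen → Fin 3 → Fin 3 → ℂ} {D : Gen → Gen → Fin 3 → ℂ}
    (hD : D = fun x y j => ∑ k, genChi h x k * f y k j + genEps x * genChi h y j)
    (ca : ∀ j, D .c .a j = D .a .c j - h * D .c .c j)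
    (cd : ∀ j, D .c .d j = D .d .c j - h * D .c .c j)
    (db : ∀ j, D .d .b j = D .b .d j + h * (0 - D .d .d j))
    (ab : ∀ j, D .a .b j = D .b .a j + h * (0 - D .a .a j))
    (cb : ∀ j, D .c .b j = D .b .c j - h * D .a .c j - h * D .d .c j + h * h * D .c .c j)
    (da : ∀ j, D .d .a j = D .b .c j + 0 - h * D .d .c j)
    (ad : ∀ j, D .a .d j = D .b .c j - h * D .a .c j + 0)
    (yd : ∀ i j s,
      ∑ k, (f .a i k * (∑ m, genChi h .a m * tableF h j k m s + genEps .a * tableChi h j k s) +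
        f .c i k * (∑ m, genChi h .b m * tableF h j k m s + genEps .b * tableChi h j k s)) =
      ∑ k, (f .a k j * (∑ m, tableChi h k i m * genF h .a m s +
          (if i = k then 1 else 0) * genChi h .a s) +
        f .b k j * (∑ m, tableChi h k i m * genF h .c m s +
          (if i = k then 1 else 0) * genChi h .c s)))
    (x : Gen) (i j : Fin 3) : f x i j = genF h x i j := by
  subst hD
  have ab0 := ab 0
  have ab1 := ab 1
  have ab2 := ab 2
  have ad0 := ad 0
  have ad1 := ad 1
  have ad2 := ad 2
  have ca0 := ca 0
  have ca1 := ca 1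
  have ca2 := ca 2
  have cb0 := cb 0
  have cd0 := cd 0
  have cd1 := cd 1
  have cd2 := cd 2
  have da0 := da 0
  have db0 := db 0
  have db1 := db 1
  have db2 := db 2
  have yd002 := yd 0 0 2
  have yd010 := yd 0 1 0
  have yd012 := yd 0 1 2
  have yd100 := yd 1 0 0
  have yd101 := yd 1 0 1
  have yd102 := yd 1 0 2
  have yd111 := yd 1 1 1
  have yd112 := yd 1 1 2
  have yd120 := yd 1 2 0
  have yd121 := yd 1 2 1
  have yd122 := yd 1 2 2
  have yd200 := yd 2 0 0
  have yd201 := yd 2 0 1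
  have yd202 := yd 2 0 2
  have yd210 := yd 2 1 0
  have yd211 := yd 2 1 1
  have yd212 := yd 2 1 2
  have yd221 := yd 2 2 1
  have yd222 := yd 2 2 2
  simp only [Fin.sum_univ_three, tableF, tableChi, genChi, genF, genEps, SL.pick,
    Matrix.of_apply, Matrix.cons_val, Matrix.zero_apply, Fin.reduceEq, if_true, if_false, mul_zero,
    zero_mul, add_zero, zero_add, mul_one, one_mul]
    at ab0 ab1 ab2 ad0 ad1 ad2 ca0 ca1 ca2 cb0 cd0 cd1 cd2 da0 db0 db1 db2 yd002
      yd010 yd012 yd100 yd101 yd102 yd111 yd112 yd120 yd121 yd122 yd200 yd201 yd202 yd210 yd211 yd212 yd221 yd222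
  -- Elimination in triangular order. All coefficients are polynomial in `h` over the rationals,
  -- with no division by `h`, so every `h` is covered.
  have a20 : f .a 2 0 = 0 := by
    linear_combination (-1 / 2) * yd200
  have c21 : f .c 2 1 = 0 := by
    linear_combination (1) * yd211
  have a21 : f .a 2 1 = 0 := by
    linear_combination (-1 / 4) * yd210 + (-1) * h * c21
  have c01 : f .c 0 1 = 0 := by
    linear_combination (-1) * ca1 + (1) * a21 + (1) * h * c21
  have d21 : f .d 2 1 = 0 := by
    linear_combination (1) * cd1 + (-1) * c01 + (-3) * h * c21
  have a01 : f .a 0 1 = 0 := by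
    linear_combination (-1 / 2) * yd010 + (-2) * h * c01 + (3) * h * a21
  have c11 : f .c 1 1 = 0 := by
    linear_combination (1) * yd111 + (2) * a01
  have c20 : f .c 2 0 = 0 := by
    linear_combination (1) * yd201 + (-2) * a21 + (-4) * h * c21
  have b21 : f .b 2 1 = 0 := by
    linear_combination (-1) * yd212 + (2) * a01 + (1) * a20 + (4) * h * a21 + (-8) * h ^ 2 * c21
  have c22 : f .c 2 2 = 0 := by
    linear_combination (1) * yd221 + (1) * a20 + (2) * h * c20
  have c00 : f .c 0 0 = 0 := by
    linear_combination (-1) * ca0 + (1) * a20 + (1) * h * c20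
  have d20 : f .d 2 0 = 0 := by
    linear_combination (1) * cd0 + (-1) * c00 + (-3) * h * c20
  have d01 : f .d 0 1 = 0 := by
    linear_combination (1) * ad1 + (-1) * h * c01 + (1) * c11
  have a00 : f .a 0 0 = 1 := by
    linear_combination (-1 / 2) * da0 + (-1 / 2) * ab1 + (-1 / 2) * yd101 + (-1 / 2) * yd012 +
      (-1 / 2) * h * c00 + (-1 / 2) * h * a01 + (-4) * h ^ 2 * c01 + (2) * h * c11 +
      (-1) * h * a20 + (-1) * h ^ 2 * c20 + (-3 / 2) * h ^ 2 * a21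
  have c10 : f .c 1 0 = 0 := by
    linear_combination (-1) * da0 + (-1) * a00 + (-1) * h * c00 + (-2) * h * a20 +
      (-2) * h ^ 2 * c20
  have d00 : f .d 0 0 = 1 := by
    linear_combination (1) * ad0 + (-1) * h * c00 + (1) * c10
  have a10 : f .a 1 0 = 2 * h := by
    linear_combination (1 / 2) * yd100 + (2) * h * a00
  have a11 : f .a 1 1 = 1 := by
    linear_combination (1 / 2) * yd101 + (1) * a00 + (-1 / 2) * c10 + (-2) * h * c11
  have b11 : f .b 1 1 = 2 * h := by
    linear_combination (-1) * yd112 + (-2) * h ^ 2 * a01 + (1) * a10 + (-8) * h ^ 2 * c11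
  have b00 : f .b 0 0 = 0 := by
    linear_combination (1) * ab0 + (-1) * h * a00 + (1) * a10
  have b01 : f .b 0 1 = 0 := by
    linear_combination (1) * ab1 + (-1) * h * a01 + (1) * a11
  have b20 : f .b 2 0 = 0 := by
    linear_combination (1) * cb0 + (1) * c10 + (3) * h ^ 2 * c20
  have a02 : f .a 0 2 = -h := by
    linear_combination (-1 / 2) * yd002 + (-1 / 2) * b00 + (-1 / 2) * a10 + (-3 / 2) * h ^ 2 * a20
  have c12 : f .c 1 2 = 0 := by
    linear_combination (1) * yd121 + (2) * a02 + (1) * a10 + (2) * h * c10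
  have a22 : f .a 2 2 = 1 := by
    linear_combination (-1 / 2) * yd202 + (1) * a00 + (3) * h * a20 + (-1 / 2) * b20
  have b22 : f .b 2 2 = -2 * h := by
    linear_combination (-1) * yd222 + (2) * a02
  have c02 : f .c 0 2 = 0 := by
    linear_combination (-1) * ca2 + (1) * a22 + (1) * h * c22
  have d22 : f .d 2 2 = 1 := by
    linear_combination (1) * cd2 + (-1) * c02 + (-3) * h * c22
  have d10 : f .d 1 0 = -2 * h := by
    linear_combination (-1) * db0 + (-1) * b00 + (-1) * h * d00 + (-2) * h * b20 +
      (-2) * h ^ 2 * d20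
  have d11 : f .d 1 1 = 1 := by
    linear_combination (-1) * db1 + (-1) * b01 + (-1) * h * d01 + (-2) * h * b21 +
      (-2) * h ^ 2 * d21
  have d02 : f .d 0 2 = h := by
    linear_combination (1) * ad2 + (-1) * h * c02 + (1) * c12
  have a12 : f .a 1 2 = h ^ 2 := by
    linear_combination (1 / 4) * yd120 + (1) * h * a02 + (1) * h * a10 + (2) * h ^ 2 * c10 +
      (-1) * h * c12
  have b12 : f .b 1 2 = -2 * h ^ 3 := by
    linear_combination (-1) * yd122 + (-2) * h ^ 2 * a02 + (-4) * h * a12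
  have b02 : f .b 0 2 = 2 * h ^ 2 := by
    linear_combination (1) * ab2 + (-1) * h * a02 + (1) * a12
  have b10 : f .b 1 0 = 0 := by
    linear_combination (-1) * yd102 + (-2) * h ^ 2 * a00 + (2) * h * a10 + (-2) * a12
  have d12 : f .d 1 2 = -3 * h ^ 2 := by
    linear_combination (-1) * db2 + (-1) * b02 + (-1) * h * d02 + (-2) * h * b22 +
      (-2) * h ^ 2 * d22
  cases x <;> fin_cases i <;> fin_cases j <;> simp [genF, a20, c21, a21, c01, d21, a01, c11, c20, b21, c22, c00, d20, d01, a00, c10, d00, a10, a11,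
    b11, b00, b01, b20, a02, c12, a22, b22, c02, d22, d10, d11, d02, a12, b12, b02, b10, d12]

namespace BicovariantCalculus.IsCoord

variable {C : BicovariantCalculus (SL h) Γ} {c : Fin 3 → Γ →ₗ[ℂ] ℂ}

theorem contract_coactR_gen (hc : C.IsCoord c) (p q : Fin 2) (j : Fin 3) :
    TensorProduct.lid ℂ _ ((c j).rTensor (SL h)
      (C.coactR (C.proj (C.d (SL.gen h (Gen.mat p q)))))) =
    ∑ k, ∑ l, coordChi C c j (SL.gen h (Gen.mat k l)) •
      (SL.antipodeLin h (SL.gen h (Gen.mat p k)) * SL.gen h (Gen.mat l q)) := by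
  rw [C.coactR_proj_d_gen]
  simp only [map_sum, LinearMap.rTensor_tmul, TensorProduct.lid_tmul, hc.proj_apply]
  rfl

/-- Two expressions for the coaction on `P(dd)`: the adjoint formula, and linearity after expanding
`P(dd)` in the `θₘ`. -/
theorem sum_coordChi_gen_d (hc : C.IsCoord c) (j : Fin 3) :
    ∑ k, ∑ l, coordChi C c j (SL.gen h (Gen.mat k l)) •
      (SL.antipodeLin h (SL.gen h (Gen.mat 1 k)) * SL.gen h (Gen.mat l 1)) =
    ∑ m, coordChi C c m (SL.gen h .d) • ∑ k, ∑ l, coordChi C c j (SL.gen h (Gen.mat k l)) •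
      (SL.antipodeLin h (SL.gen h (Gen.mat (![0, 0, 1] m) k)) *
        SL.gen h (Gen.mat l (![0, 1, 0] m))) := by
  simp only [← hc.contract_coactR_gen]
  rw [hc.proj_eq (C.d (SL.gen h (Gen.mat 1 1))), map_sum, map_sum, map_sum]
  refine Finset.sum_congr rfl fun m _ => ?_
  rw [map_smul, map_smul, map_smul]
  fin_cases m <;> rfl

theorem coordChi_gen_d (hc : C.IsCoord c) (j : Fin 3) :
    coordChi C c j (SL.gen h .d) = genChi h .d j := by
  have ha := hc.coordChi_gen 0
  have hb := hc.coordChi_gen 1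
  have hcc := hc.coordChi_gen 2
  simp only [Matrix.cons_val] at ha hb hcc
  -- The functionals of the reference calculus serve as scalar tests for an identity in `A`.
  have key (j k : Fin 3) := congrArg (refChi h k) (hc.sum_coordChi_gen_d j)
  simp only [Fin.sum_univ_two, Fin.sum_univ_three, Gen.mat, Matrix.cons_val, ha, hb, hcc] at key
  -- A priori these equations are quadratic in the coordinates of `P(dd)`. Solved in the order
  -- `k11`, `k21`, `k20`, each yields one coordinate.
  have k11 := key 1 1
  have k20 := key 2 0
  have k21 := key 2 1
  simp [SL.antipodeLin_gen, SL.pick, refChi_mul, refF_gen, refChi_gen, genF, genChi,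
    SL.counit_gen_eq, genEps, Fin.sum_univ_three] at k11 k20 k21
  have hx : coordChi C c 0 (SL.gen h .d) = -1 := by
    rw [k11] at k21
    linear_combination k21
  have hz : coordChi C c 2 (SL.gen h .d) = -2 * h := by
    rw [k11, hx] at k20
    linear_combination -k20 / 2
  fin_cases j
  exacts [hx, k11, hz]

theorem coordChi_gen_eq (hc : C.IsCoord c) (x : Gen) (j : Fin 3) :
    coordChi C c j (SL.gen h x) = genChi h x j := by
  cases x
  · exact (hc.coordChi_gen 0 j).trans (by fin_cases j <;> rfl)
  · exact (hc.coordChi_gen 1 j).trans (by fin_cases j <;> rfl)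
  · exact (hc.coordChi_gen 2 j).trans (by fin_cases j <;> rfl)
  · exact hc.coordChi_gen_d j

/-- Once the expansion of `P(dd)` is known, the adjoint formula for the coaction collapses to the
reference matrix. -/
theorem isCoactionMatrix_refV (hc : C.IsCoord c) :
    C.IsCoactionMatrix (JordanianSL2.theta C) (refV h) := by
  have hS (x : SL h) : SL.antipodeLin h x = antipode ℂ x := rfl
  have key (p q : Fin 2) : C.coactR (C.proj (C.d (SL.gen h (Gen.mat p q)))) =
      ∑ j, JordanianSL2.theta C j ⊗ₜ refRow h p q j := by
    have hp (x : Gen) : C.proj (C.d (SL.gen h x)) =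
        ∑ i, genChi h x i • JordanianSL2.theta C i := by
      simp only [hc.proj_eq (C.d _), ← hc.coordChi_gen_eq, coordChi_apply]
    rw [C.coactR_proj_d_gen]
    simp only [hp]
    simp [Fin.sum_univ_two, Fin.sum_univ_three, genChi, Gen.mat, refRow, hS,
      TensorProduct.add_tmul, TensorProduct.tmul_sub,
      ← TensorProduct.smul_tmul']
    module
  intro i
  fin_cases i
  · exact key 0 0
  · exact key 0 1
  · exact key 1 0

theorem coordF_gen_eq (hc : C.IsCoord c) (x : Gen) (i j : Fin 3) :
    coordF C c i j (SL.gen h x) = genF h x i j := by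
  have hmul (x y : Gen) (j : Fin 3) : coordChi C c j (SL.gen h x * SL.gen h y) =
      ∑ k, genChi h x k * coordF C c k j (SL.gen h y) + genEps x * genChi h y j := by
    rw [hc.coordChi_mul]
    simp only [hc.coordChi_gen_eq, SL.counit_gen_eq]
  obtain ⟨ca, cd, db, ab, cb, da, ad⟩ := SL.isPoint (h := h)
  -- By the Leibniz rule, `χⱼ` of a quadratic relation is linear in the unknown values of `f` on
  -- generators.
  have rel {u v : SL h} (H : u = v) (j : Fin 3) := congrArg (coordChi C c j) H
  refine eq_genF (f := fun x i j => coordF C c i j (SL.gen h x))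
    (D := fun x y j => coordChi C c j (SL.gen h x * SL.gen h y)) ?_ ?_ ?_ ?_ ?_ ?_ ?_ ?_ ?_ x i j
  · funext x y j
    exact hmul x y j
  · intro j
    simpa only [map_sub, map_smul, smul_eq_mul] using rel ca j
  · intro j
    simpa only [map_sub, map_smul, smul_eq_mul] using rel cd j
  · intro j
    simpa only [map_add, map_sub, map_smul, smul_eq_mul, hc.coordChi_one] using rel db j
  · intro j
    simpa only [map_add, map_sub, map_smul, smul_eq_mul, hc.coordChi_one] using rel ab j
  · intro j
    simpa only [map_add, map_sub, map_smul, smul_eq_mul] using rel cb j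
  · intro j
    simpa only [map_add, map_sub, map_smul, smul_eq_mul, hc.coordChi_one] using rel da j
  · intro j
    simpa only [map_add, map_sub, map_smul, smul_eq_mul, hc.coordChi_one] using rel ad j
  · intro i j s
    -- Right covariance at the generator `a`, tested with the reference functionals, supplies the
    -- remaining linear equations.
    have key := congrArg (refChi h s)
      (hc.sum_starAct_coordF_mul hc.isCoactionMatrix_refV i j (SL.gen h .a))
    have hstar (k : Fin 3) : starAct (coordF C c i k) (SL.gen h .a) =
        coordF C c i k (SL.gen h .a) • SL.gen h .a +
        coordF C c i k (SL.gen h .c) • SL.gen h .b := by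
      have := SL.comul_gen (h := h) 0 0
      simp only [Gen.mat, Fin.sum_univ_two, Matrix.cons_val] at this
      simp [starAct, this]
    have hcostar (k : Fin 3) : costarLin (coordF C c k j) (SL.gen h .a) =
        coordF C c k j (SL.gen h .a) • SL.gen h .a +
        coordF C c k j (SL.gen h .b) • SL.gen h .c := by
      have := SL.comul_gen (h := h) 0 0
      simp only [Gen.mat, Fin.sum_univ_two, Matrix.cons_val] at this
      simp [costarLin, this]
    simpa only [hstar, hcostar, map_sum, add_mul, mul_add, smul_mul_assoc, mul_smul_comm, map_add,
      map_smul, smul_eq_mul, refChi_mul, refF_refV, refChi_refV, refChi_gen, refF_gen,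
      SL.counit_gen_eq, counit_refV] using key

theorem coord_eq (hc : C.IsCoord c) (x : SL h) :
    (∀ i j, coordF C c i j x = refF h i j x) ∧ ∀ j, coordChi C c j x = refChi h j x := by
  induction x using SL.induction with
  | hs r =>
    simp [Algebra.algebraMap_eq_smul_one, hc.coordF_one, refF_one, hc.coordChi_one, refChi_one]
  | hg x => simp [hc.coordF_gen_eq, refF_gen, hc.coordChi_gen_eq, refChi_gen]
  | ha x y hx hy => simp [hx, hy]
  | hm x y hx hy =>
    simp [hc.coordF_mul, refF_mul, hc.coordChi_mul, refChi_mul, hx, hy]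

end BicovariantCalculus.IsCoord

end Uniqueness

/-! ### The quantum Lie algebra of a 3D calculus -/

section Brackets

open Coalgebra HopfAlgebra

variable {h : ℂ}

theorem convol_apply (φ ψ : Module.Dual ℂ (SL h)) (x : SL h) :
    convol φ ψ x = ψ (costarLin φ x) := by
  have key (X : SL h ⊗[ℂ] SL h) : LinearMap.mul' ℂ ℂ (TensorProduct.map φ ψ X) =
      ψ (TensorProduct.lid ℂ _ (φ.rTensor _ X)) := by
    induction X using TensorProduct.induction_on with
    | zero => simp
    | add X Y hX hY => simp only [map_add, hX, hY]
    | tmul u v => simp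
  exact key (comul x)

theorem apply_starAct (φ ψ : Module.Dual ℂ (SL h)) (x : SL h) :
    φ (starAct ψ x) = convol φ ψ x := by
  have key (X : SL h ⊗[ℂ] SL h) : φ (TensorProduct.rid ℂ _ (ψ.lTensor _ X)) =
      LinearMap.mul' ℂ ℂ (TensorProduct.map φ ψ X) := by
    induction X using TensorProduct.induction_on with
    | zero => simp
    | add X Y hX hY => simp only [map_add, hX, hY]
    | tmul u v => simp [mul_comm]
  exact key (comul x)

/-- Groups `φ(x₍₂₎) x₍₃₎` into a single factor, to which right covariance of the differential
applies. -/
theorem qbracket_apply (φ ψ : Module.Dual ℂ (SL h)) (x : SL h) : qbracket φ ψ x =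
    ψ (LinearMap.mul' ℂ _ (TensorProduct.map (antipode ℂ) (costarLin φ) (comul (R := ℂ) x))) := by
  have key (X : SL h ⊗[ℂ] SL h) : LinearMap.mul' ℂ ℂ (TensorProduct.map φ ψ
      ((LinearMap.mul' ℂ (SL h) ∘ₗ (antipode ℂ (A := SL h)).rTensor (SL h)).lTensor (SL h)
        (TensorProduct.leftComm ℂ _ _ _ ((comul (R := ℂ) (A := SL h)).lTensor (SL h) X)))) =
      ψ (LinearMap.mul' ℂ _ (TensorProduct.map (antipode ℂ) (costarLin φ) X)) := by
    induction X using TensorProduct.induction_on with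
    | zero => simp
    | add X Y hX hY => simp only [map_add, hX, hY]
    | tmul u v =>
      simp only [LinearMap.lTensor_tmul, TensorProduct.map_tmul, costarLin, LinearMap.comp_apply]
      generalize comul (R := ℂ) v = Z
      induction Z using TensorProduct.induction_on with
      | zero => simp
      | add X Y hX hY => simp only [TensorProduct.tmul_add, map_add, hX, hY]
      | tmul s t => simp
  exact key (comul x)

/-- Replace `χᵢ(x₍₂₎) x₍₃₎` by `∑ₜ (χₜ ⋆ x₍₂₎) vᵢₜ`; the antipode then leaves `∑ₜ χₜ(x) vᵢₜ`, to
which `χₖ` is applied. -/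
theorem qbracket_refChi (i k : Fin 3) :
    qbracket (refChi h i) (refChi h k) = ∑ t, tableChi h i t k • refChi h t := by
  have key (X : SL h ⊗[ℂ] SL h) :
      LinearMap.mul' ℂ _ (TensorProduct.map (antipode ℂ) (costarLin (refChi h i)) X) =
      ∑ t, LinearMap.mul' ℂ _ (TensorProduct.map (antipode ℂ) (starLin (refChi h t)) X) *
        refV h i t := by
    induction X using TensorProduct.induction_on with
    | zero => simp
    | add X Y hX hY => simp only [map_add, hX, hY, add_mul, Finset.sum_add_distrib]
    | tmul u v =>
      simp [← sum_starAct_refChi_mul, Finset.mul_sum, starLin_apply, mul_assoc]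
  ext x
  rw [qbracket_apply, key]
  simp only [antipode_mul_starAct, smul_mul_assoc, one_mul, map_sum, map_smul, refChi_refV,
    LinearMap.sum_apply, LinearMap.smul_apply, smul_eq_mul, mul_comm]

/-- Apply the product rule of `χₖ` to `∑ₜ (χₜ ⋆ x) vᵢₜ`: the term with `f` gives the braided flip,
the term with the counit gives the bracket. -/
theorem convol_refChi (i k : Fin 3) : convol (refChi h i) (refChi h k) =
    ∑ s, ∑ t, tableF h i t s k • convol (refChi h s) (refChi h t) +
      ∑ t, tableChi h i t k • refChi h t := by
  ext x
  rw [convol_apply, ← sum_starAct_refChi_mul, map_sum]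
  simp only [refChi_mul, refF_refV, refChi_refV, apply_starAct, counit_starAct,
    Finset.sum_add_distrib, LinearMap.add_apply, LinearMap.sum_apply, LinearMap.smul_apply,
    smul_eq_mul, mul_comm]
  rw [Finset.sum_comm]

theorem bracketTable_refChi : BracketTable h qbracket (refChi h 0) (refChi h 1) (refChi h 2) := by
  refine ⟨?_, ?_, ?_, ?_, ?_, ?_, ?_, ?_, ?_⟩ <;> rw [qbracket_refChi, Fin.sum_univ_three] <;>
    simp [tableChi, sub_eq_add_neg]

/-- The braided flips, for an arbitrary bilinear product. -/
theorem braidedFlipTable_tableF {V W : Type*} [AddCommGroup W] [Module ℂ W] (m : V → V → W)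
    (χ : Fin 3 → V) : BraidedFlipTable h m (χ 0) (χ 1) (χ 2)
      (fun i k => ∑ s, ∑ t, tableF h i t s k • m (χ s) (χ t)) := by
  refine ⟨?_, ?_, ?_, ?_, ?_, ?_, ?_, ?_, ?_⟩ <;>
    simp only [Fin.sum_univ_three, tableF, Matrix.cons_val, zero_smul, one_smul,
      zero_add, add_zero, neg_mul, neg_smul, sub_eq_add_neg, add_assoc]

theorem commutatorTable_refChi :
    CommutatorTable h qbracket convol (refChi h 0) (refChi h 1) (refChi h 2) := by
  obtain ⟨b00, -, -, -, b11, -⟩ := bracketTable_refChi (h := h)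
  obtain ⟨-, t01, t02, t10, -, t12, t20, t21, t22⟩ :=
    braidedFlipTable_tableF (h := h) convol (refChi h)
  have key {i k : Fin 3} {w : Module.Dual ℂ (SL h)}
      (hw : ∑ s, ∑ t, tableF h i t s k • convol (refChi h s) (refChi h t) = w) :
      qbracket (refChi h i) (refChi h k) = convol (refChi h i) (refChi h k) - w := by
    rw [qbracket_refChi, eq_sub_iff_add_eq', ← hw, ← convol_refChi]
  exact ⟨b00, key t01, key t02, key t10, b11, key t12, key t20, key t21, key t22⟩

end Brackets

/-! ### The pairing and the dual basis -/

section QuantumLie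

open Coalgebra HopfAlgebra

variable {h : ℂ} {Γ : Type*} [AddCommGroup Γ] [Module ℂ Γ] [Module (SL h) Γ]
  [Module (SL h)ᵐᵒᵖ Γ] [SMulCommClass (SL h) (SL h)ᵐᵒᵖ Γ] [IsScalarTower ℂ (SL h) Γ]
  [IsScalarTower ℂ (SL h)ᵐᵒᵖ Γ]

theorem BicovariantCalculus.IsPairing.unique {C : BicovariantCalculus (SL h) Γ}
    {B B' : Γ →ₗ[ℂ] C.quantumLie →ₗ[ℂ] ℂ} (hB : C.IsPairing B) (hB' : C.IsPairing B') : B = B' := by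
  ext ω χ
  have hω : ω ∈ Submodule.span ℂ {ω : Γ | ∃ a b : SL h, ω = a • C.d b} := by
    rw [C.span_d]
    trivial
  induction hω using Submodule.span_induction with
  | mem ω hω =>
    obtain ⟨a, b, rfl⟩ := hω
    rw [hB.smul, hB'.smul, hB.d, hB'.d]
  | zero => simp
  | add ω ω' _ _ hω hω' => simp only [map_add, LinearMap.add_apply, hω, hω']
  | smul r ω _ hω => simp only [map_smul, LinearMap.smul_apply, hω]

namespace BicovariantCalculus.IsCoord

variable {C : BicovariantCalculus (SL h) Γ} {c : Fin 3 → Γ →ₗ[ℂ] ℂ}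

/-- An element of the quantum Lie algebra is determined by its values at `a, b, c`, because `ker ε /
R` is spanned by the classes of `a - 1, b, c`. -/
theorem sum_coordChi_mul (hc : C.IsCoord c) (χ : C.quantumLie) (x : SL h) :
    ∑ i, coordChi C c i x * (χ : Module.Dual ℂ (SL h)) (SL.gen h (![.a, .b, .c] i)) =
      (χ : Module.Dual ℂ (SL h)) x := by
  obtain ⟨χ, hχ⟩ := χ
  rw [quantumLie, Submodule.mem_dualAnnihilator] at hχ
  have h₁ : χ 1 = 0 :=
    hχ 1 (Submodule.mem_sup_left (Submodule.subset_span (Set.mem_singleton 1)))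
  have hd : C.proj (C.d 1) = 0 := by
    rw [hc.proj_eq]
    exact Finset.sum_eq_zero fun i _ => by rw [← coordChi_apply, hc.coordChi_one, zero_smul]
  have hθ (i : Fin 3) : C.proj (C.d (SL.gen h (![.a, .b, .c] i))) = JordanianSL2.theta C i := by
    fin_cases i <;> rfl
  -- Subtracting counits puts the element in `ker ε`; the coefficients are those of `P(dx)`, so `P ∘
  -- d` kills it and it lies in `R`.
  have h₂ := hχ (x - counit (R := ℂ) x • 1 - ∑ i, coordChi C c i x •
    (SL.gen h (![.a, .b, .c] i) - counit (R := ℂ) (SL.gen h (![.a, .b, .c] i)) • 1)) (by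
      refine Submodule.mem_sup_right ⟨?_, ?_⟩
      · simp
      · rw [SetLike.mem_coe, LinearMap.mem_ker, LinearMap.comp_apply]
        simp only [map_sub, map_smul, map_sum, hd, hθ, smul_zero, sub_zero]
        rw [hc.proj_eq]
        exact sub_self _)
  simp only [map_sub, map_smul, map_sum, h₁, smul_eq_mul, mul_zero, sub_zero] at h₂
  exact (sub_eq_zero.mp h₂).symm

theorem coordChi_mem (hc : C.IsCoord c) (j : Fin 3) : coordChi C c j ∈ C.quantumLie := by
  rw [quantumLie, Submodule.dualAnnihilator_sup_eq, Submodule.mem_inf]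
  constructor <;> rw [Submodule.mem_dualAnnihilator]
  · intro x hx
    obtain ⟨r, rfl⟩ := Submodule.mem_span_singleton.mp hx
    rw [map_smul, hc.coordChi_one, smul_zero]
  · intro x hx
    rw [coordChi_apply, ← hc.proj_apply, show C.proj (C.d x) = 0 from hx.2, map_zero]

/-- The pairing of forms with the quantum Lie algebra, in coordinates. -/
theorem exists_isPairing (hc : C.IsCoord c) : ∃ B : Γ →ₗ[ℂ] C.quantumLie →ₗ[ℂ] ℂ,
    C.IsPairing B := by
  refine ⟨∑ i, (c i).smulRight
    (LinearMap.applyₗ (SL.gen h (![.a, .b, .c] i)) ∘ₗ C.quantumLie.subtype), fun a ω χ => ?_,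
    fun a χ => ?_⟩
  · simp [hc.smul, Finset.mul_sum, mul_assoc]
  · rw [← hc.sum_coordChi_mul]
    simp [coordChi_apply]

/-- The pairing cannot distinguish `ω` from `P(ω)`, because `ε ∘ S = ε`. -/
theorem pairing_theta {B : Γ →ₗ[ℂ] C.quantumLie →ₗ[ℂ] ℂ} (hB : C.IsPairing B) (i : Fin 3)
    (χ : C.quantumLie) : B (JordanianSL2.theta C i) χ =
      (χ : Module.Dual ℂ (SL h)) (SL.gen h (![.a, .b, .c] i)) := by
  have hθ : JordanianSL2.theta C i = C.proj (C.d (SL.gen h (![.a, .b, .c] i))) := by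
    fin_cases i <;> rfl
  have key (Z : SL h ⊗[ℂ] Γ) : B (TensorProduct.lift (lact (SL h) Γ ∘ₗ antipode ℂ) Z) χ =
      B (TensorProduct.lid ℂ _ ((counit (R := ℂ) (A := SL h)).rTensor Γ Z)) χ := by
    induction Z using TensorProduct.induction_on with
    | zero => simp
    | add X Y hX hY => simp only [map_add, LinearMap.add_apply, hX, hY]
    | tmul x ω => simp [lact, hB.smul]
  rw [hθ, proj, LinearMap.comp_apply, key, C.counitL, hB.d]

theorem exists_basis (hc : C.IsCoord c) {B : Γ →ₗ[ℂ] C.quantumLie →ₗ[ℂ] ℂ}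
    (hB : C.IsPairing B) : ∃ χ : Module.Basis (Fin 3) ℂ C.quantumLie,
      ∀ i j, B (JordanianSL2.theta C i) (χ j) = if i = j then 1 else 0 := by
  have hχ (v : Fin 3 → ℂ) (i : Fin 3) : B (JordanianSL2.theta C i)
      (∑ j, v j • (⟨coordChi C c j, hc.coordChi_mem j⟩ : C.quantumLie)) = v i := by
    simp [pairing_theta hB, hc.coordChi_gen]
  -- Pairing with the `θᵢ` is inverse to forming combinations of the `coordChi C c j`, so these are
  -- the dual basis.
  let e : C.quantumLie ≃ₗ[ℂ] (Fin 3 → ℂ) := LinearEquiv.ofLinearMap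
    (LinearMap.pi fun i => B (JordanianSL2.theta C i))
    (∑ j, (LinearMap.proj j).smulRight ⟨coordChi C c j, hc.coordChi_mem j⟩)
    (by
      refine LinearMap.ext fun v => funext fun i => Eq.trans ?_ (hχ v i)
      simp only [LinearMap.comp_apply, LinearMap.pi_apply, LinearMap.sum_apply,
        LinearMap.smulRight_apply, LinearMap.proj_apply])
    (by
      refine LinearMap.ext fun χ => Subtype.ext (LinearMap.ext fun x =>
        Eq.trans ?_ (hc.sum_coordChi_mul χ x))
      simp [pairing_theta hB, mul_comm])
  refine ⟨Module.Basis.ofEquivFun e, fun i j => ?_⟩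
  have : B (JordanianSL2.theta C i) (Module.Basis.ofEquivFun e j) =
      e (Module.Basis.ofEquivFun e j) i := rfl
  rw [this, Module.Basis.coe_ofEquivFun, LinearEquiv.apply_symm_apply, Pi.single_apply]

theorem eq_refChi (hc : C.IsCoord c) {B : Γ →ₗ[ℂ] C.quantumLie →ₗ[ℂ] ℂ} (hB : C.IsPairing B)
    {χ : Fin 3 → C.quantumLie}
    (hχ : ∀ i j, B (JordanianSL2.theta C i) (χ j) = if i = j then 1 else 0) (j : Fin 3) :
    (χ j : Module.Dual ℂ (SL h)) = refChi h j := by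
  ext x
  rw [← hc.sum_coordChi_mul, ← (hc.coord_eq x).2 j]
  simp only [← pairing_theta hB, hχ]
  simp

end BicovariantCalculus.IsCoord

end QuantumLie

end JordanianSL2

theorem mainTheorem7 (h : ℂ) :
    (∃ (Γ : Type) (_ : AddCommGroup Γ) (_ : Module ℂ Γ) (_ : Module (SL h) Γ)
      (_ : Module (SL h)ᵐᵒᵖ Γ) (_ : SMulCommClass (SL h) (SL h)ᵐᵒᵖ Γ)
      (_ : IsScalarTower ℂ (SL h) Γ) (_ : IsScalarTower ℂ (SL h)ᵐᵒᵖ Γ)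
      (C : BicovariantCalculus (SL h) Γ), IsThreeDim C) ∧
    ∀ (Γ : Type*) [AddCommGroup Γ] [Module ℂ Γ] [Module (SL h) Γ] [Module (SL h)ᵐᵒᵖ Γ]
      [SMulCommClass (SL h) (SL h)ᵐᵒᵖ Γ] [IsScalarTower ℂ (SL h) Γ]
      [IsScalarTower ℂ (SL h)ᵐᵒᵖ Γ] (C : BicovariantCalculus (SL h) Γ), IsThreeDim C →
      (∃! f : Fin 3 → Fin 3 → Module.Dual ℂ (SL h), IsCommutation (theta C) f) ∧
      (∃! v : Fin 3 → Fin 3 → SL h, C.IsCoactionMatrix (theta C) v) ∧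
      (∃! B : Γ →ₗ[ℂ] C.quantumLie →ₗ[ℂ] ℂ, C.IsPairing B) ∧
      ∀ B : Γ →ₗ[ℂ] C.quantumLie →ₗ[ℂ] ℂ, C.IsPairing B →
        (∃! χ : Module.Basis (Fin 3) ℂ C.quantumLie,
          ∀ i j, B (theta C i) (χ j) = if i = j then 1 else 0) ∧
        ∀ χ : Module.Basis (Fin 3) ℂ C.quantumLie,
          (∀ i j, B (theta C i) (χ j) = if i = j then 1 else 0) →
          BracketTable h qbracket (χ 0 : Module.Dual ℂ (SL h)) (χ 1) (χ 2) ∧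
          CommutatorTable h qbracket convol (χ 0 : Module.Dual ℂ (SL h)) (χ 1) (χ 2) ∧
          ∀ (f : Fin 3 → Fin 3 → Module.Dual ℂ (SL h)) (v : Fin 3 → Fin 3 → SL h),
            IsCommutation (theta C) f → C.IsCoactionMatrix (theta C) v →
            (∀ i k, qbracket (χ i : Module.Dual ℂ (SL h)) (χ k) =
              convol (χ i : Module.Dual ℂ (SL h)) (χ k) -
                ∑ s, ∑ t, braiding f v s t i k •
                  convol (χ s : Module.Dual ℂ (SL h)) (χ t)) ∧
            BraidedFlipTable h (fun x y => x ⊗ₜ[ℂ] y) (χ 0) (χ 1) (χ 2)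
              (fun i k => ∑ s, ∑ t, braiding f v s t i k • (χ s ⊗ₜ[ℂ] χ t)) := by
  refine ⟨⟨Forms h, inferInstance, inferInstance, inferInstance, inferInstance, inferInstance,
    inferInstance, inferInstance, Forms.calculus h, Forms.isThreeDim_calculus⟩, ?_⟩
  intro Γ _ _ _ _ _ _ _ C hC
  obtain ⟨c, hc⟩ := C.exists_isCoord hC
  obtain ⟨B₀, hB₀⟩ := hc.exists_isPairing
  refine ⟨⟨coordF C c, hc.isCommutation, fun f hf => hc.commutation_unique hf⟩,
    ⟨refV h, hc.isCoactionMatrix_refV,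
      fun v hv => hc.coactionMatrix_unique hv hc.isCoactionMatrix_refV⟩,
    ⟨B₀, hB₀, fun B hB => hB.unique hB₀⟩, fun B hB => ?_⟩
  obtain ⟨χ₀, hχ₀⟩ := hc.exists_basis hB
  refine ⟨⟨χ₀, hχ₀, fun χ hχ => Module.Basis.eq_of_apply_eq fun j => Subtype.ext
    ((hc.eq_refChi hB hχ j).trans (hc.eq_refChi hB hχ₀ j).symm)⟩, fun χ hχ => ?_⟩
  have href := hc.eq_refChi hB hχ
  refine ⟨?_, ?_, fun f v hf hv => ?_⟩
  · simp only [href]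
    exact bracketTable_refChi
  · simp only [href]
    exact commutatorTable_refChi
  -- Uniqueness replaces the given `f` and `v` by the known ones, whose braiding coefficients are
  -- the entries of `tableF`.
  · obtain rfl := hc.commutation_unique hf
    obtain rfl := hc.coactionMatrix_unique hv hc.isCoactionMatrix_refV
    have hbr (s t i k : Fin 3) : braiding (coordF C c) (refV h) s t i k = tableF h i t s k := by
      rw [braiding, (hc.coord_eq _).1, refF_refV]
    simp only [hbr]
    refine ⟨fun i k => ?_, braidedFlipTable_tableF _ χ⟩
    simp only [href]
    rw [qbracket_refChi, eq_sub_iff_add_eq', ← convol_refChi]
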